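/- Conventions. Let $X$ be a normal integral locally Noetherian scheme. A Weil divisor (resp. $\mathbb{Q}$-divisor) on $X$ is a locally finite $\mathbb{Z}$-linear (resp. $\mathbb{Q}$-linear) combination of prime divisors. For a Weil divisor $E$, $\mathcal{O}_X(E)$ is the sheaf of rational functions $\varphi$ with $\varphi=0$ or $\mathrm{div}(\varphi)+E\ge 0$. For a $\mathbb{Q}$-divisor $\Delta$ on $X$, $(X,\Delta)$ is *globally $+$-regular* if $\Delta\ge 0$ and for every finite dominant morphism $g:S\to X$ with $S$ normal and integral, the natural map $\mathcal{O}_X\to g_*\mathcal{O}_S(\lfloor g^*\Delta\rfloor)$ splits as a map of $\mathcal{O}_X$-modules. The pair $(X,\Delta)$ is *strongly globally $+$-regular* if for every effective Weil divisor $D\ge 0$ on $X$ there is a rational number $\epsilon>0$ such that $(X,\Delta+\epsilon D)$ is globally $+$-regular. A birational map $f:X\dashrightarrow Y$ is *small* if it restricts to an isomorphism between open subschemes $U\subseteq X$ and $V\subseteq Y$ whose complements have codimension at least two; then $f_*\Delta$ is the $\mathbb{Q}$-divisor on $Y$ that restricts on $V$ to the divisor corresponding to $\Delta|_U$ under $U\cong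 V$ and has no component contained in $Y\setminus V$. **Proposition.** Let $X$ and $Y$ be normal integral locally Noetherian schemes, and assume that $X$ is a Nagata scheme (for example, that $X$ is excellent). Let $\Delta$ be a $\mathbb{Q}$-divisor on $X$ such that $(X,\Delta)$ is strongly globally $+$-regular, and let $f:X\dashrightarrow Y$ be a small birational map. Then $(Y,f_*\Delta)$ is strongly globally $+$-regular. -/

import Mathlib

open CategoryTheory AlgebraicGeometry TopologicalSpace Order

universe u

noncomputable section

namespace PlusRegular

/-! ### Normal schemes and Nagata schemes -/

/-- A scheme is normal if all its local rings are integrally closed domains. -/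
class IsNormalScheme (X : Scheme.{u}) : Prop where
  isDomain_stalk (x : X) : IsDomain (X.presheaf.stalk x)
  isIntegrallyClosed_stalk (x : X) : IsIntegrallyClosed (X.presheaf.stalk x)

/-- A domain `R` is *N-2* (or *Japanese*) if its integral closure in every finite extension of its
field of fractions is a finite `R`-module. -/
def IsN2 (R : Type u) [CommRing R] [IsDomain R] : Prop :=
  ∀ (L : Type u) [Field L] [Algebra R L] [Algebra (FractionRing R) L]
    [IsScalarTower R (FractionRing R) L], Module.Finite (FractionRing R) L →
      Module.Finite R (integralClosure R L)

/-- A ring `R` is *Nagata* if it is Noetherian and `R ⧸ p` is N-2 for every prime ideal `p`. -/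
def IsNagataRing (R : Type u) [CommRing R] : Prop :=
  IsNoetherianRing R ∧ ∀ (p : Ideal R) [p.IsPrime], IsN2 (R ⧸ p)

/-- A scheme is *Nagata* if every point has an affine open neighbourhood whose ring of functions
is a Nagata ring. -/
class IsNagataScheme (X : Scheme.{u}) : Prop where
  exists_isNagataRing (x : X) : ∃ U : X.Opens, x ∈ U ∧ IsAffineOpen U ∧ IsNagataRing Γ(X, U)

/-! ### Weil divisors -/

/-- Weil divisors on `X` with coefficients in `R`: locally finite `R`-linear combinations of points
of codimension one (equivalently, of the prime divisors that are the closures of these points). -/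
def WeilDivisor (X : Scheme.{u}) (R : Type*) [AddCommGroup R] :
    AddSubgroup (AlgebraicCycle X R) where
  carrier := {D | ∀ x, D x ≠ 0 → coheight x = 1}
  zero_mem' x hx := (hx rfl).elim
  add_mem' {D E} hD hE x hx := by
    by_contra h
    exact hx (by
      rw [Function.locallyFinsuppWithin.coe_add, Pi.add_apply, not_not.1 (mt (hD x) h),
        not_not.1 (mt (hE x) h), add_zero])
  neg_mem' {D} hD x hx := hD x fun h ↦ hx (by
    rw [Function.locallyFinsuppWithin.coe_neg, Pi.neg_apply, h, neg_zero])

namespace WeilDivisor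

variable {X Y : Scheme.{u}}

/-- Apply a map `φ` with `φ 0 = 0` to all coefficients of a divisor. -/
def mapCoeff {R S : Type*} [AddCommGroup R] [AddCommGroup S] (φ : R → S) (hφ : φ 0 = 0)
    (D : WeilDivisor X R) : WeilDivisor X S where
  val :=
    { toFun x := φ (D.1 x)
      supportWithinDomain' := fun _ _ ↦ trivial
      supportLocallyFiniteWithinDomain' := fun z hz ↦ by
        obtain ⟨t, ht, h⟩ := D.1.supportLocallyFiniteWithinDomain z hz
        exact ⟨t, ht, h.subset fun x hx ↦ ⟨hx.1, fun h0 ↦ hx.2 (by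
          change φ (D.1 x) = 0
          rw [h0, hφ])⟩⟩ }
  property x hx := D.2 x fun h0 ↦ hx (by
    change φ (D.1 x) = 0
    rw [h0, hφ])

/-- The round-down `⌊D⌋` of a `ℚ`-divisor. -/
def floor (D : WeilDivisor X ℚ) : WeilDivisor X ℤ :=
  mapCoeff Int.floor Int.floor_zero D

/-- The `ℚ`-divisor `ε D` for a rational number `ε` and an integral divisor `D`. -/
def ratSMul (ε : ℚ) (D : WeilDivisor X ℤ) : WeilDivisor X ℚ :=
  mapCoeff (fun n : ℤ ↦ ε * n) (by simp) D

/-- The ramification index of `f : Y ⟶ X` at `y`: the length of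
`𝒪_{Y,y} / 𝔪_{f(y)} 𝒪_{Y,y}`. When the local rings at `y` and `f y` are discrete valuation rings
this is the order of vanishing at `y` of the pullback of a uniformizer at `f y`. -/
def ramificationIndex (f : Y ⟶ X) (y : Y) : ℕ :=
  (Module.length (Y.presheaf.stalk y) (Y.presheaf.stalk y ⧸
    (IsLocalRing.maximalIdeal (X.presheaf.stalk (f y))).map (f.stalkMap y).hom)).toNat

open Classical in
/-- The pullback `f^* D` of a `ℚ`-divisor along a finite morphism: its coefficient at a point `y` of
codimension one is the ramification index of `f` at `y` times the coefficient of `D` at `f y`. -/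
def pullback (f : Y ⟶ X) [IsFinite f] (D : WeilDivisor X ℚ) : WeilDivisor Y ℚ where
  val :=
    { toFun y := if coheight y = 1 then (ramificationIndex f y : ℚ) * D.1 (f y) else 0
      supportWithinDomain' := fun _ _ ↦ trivial
      supportLocallyFiniteWithinDomain' := fun z _ ↦ by
        obtain ⟨t, ht, h⟩ := D.1.supportLocallyFiniteWithinDomain (f z) trivial
        refine ⟨f ⁻¹' t, f.continuous.continuousAt.preimage_mem_nhds ht,
          (h.preimage' fun x _ ↦ f.finite_preimage_singleton x).subset fun y hy ↦ ⟨hy.1, ?_⟩⟩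
        intro h0
        have := hy.2
        simp_all }
  property y hy := by
    by_contra h
    exact hy (if_neg h)

open Classical in
/-- The pushforward `f_* D` of a `ℚ`-divisor along a birational map `f`, given as an isomorphism
from a dense open subscheme of `X` to a dense open subscheme of `Y`: the image of the prime
components of `D` that meet the source of `f`, with the same coefficients. -/
def pushforward [IsLocallyNoetherian Y] (f : X.PartialIso Y) (D : WeilDivisor X ℚ) :
    WeilDivisor Y ℚ where
  val :=
    { toFun y := if h : y ∈ f.target then D.1 ((f.iso.inv ≫ f.source.ι) ⟨y, h⟩) else 0
      supportWithinDomain' := fun _ _ ↦ trivial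
      supportLocallyFiniteWithinDomain' := fun z _ ↦ by
        obtain ⟨_, ⟨U, hU, rfl⟩, hz, -⟩ :=
          Y.isBasis_affineOpens.exists_subset_of_mem_open (Set.mem_univ z) isOpen_univ
        have : IsNoetherianRing Γ(Y, U) := IsLocallyNoetherian.component_noetherian ⟨U, hU⟩
        have hN : NoetherianSpace (U : Set Y) := noetherianSpace_of_isAffineOpen U hU
        have hK : IsCompact ((U : Set Y) ∩ f.target) := by
          have := (NoetherianSpace.isCompact ((Subtype.val : ↥(U : Set Y) → Y) ⁻¹' (f.target : Set Y))).image
            continuous_subtype_val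
          rwa [Subtype.image_preimage_coe] at this
        have hK' : IsCompact ((Subtype.val : f.target → Y) ⁻¹' (U : Set Y)) := by
          rw [Subtype.isCompact_iff]
          refine Eq.mp (congrArg IsCompact ?_) hK
          ext y
          exact ⟨fun h ↦ ⟨⟨y, h.2⟩, h.1, rfl⟩, by rintro ⟨y, h, rfl⟩; exact ⟨h, y.2⟩⟩
        have hfin := D.1.locallyFiniteSupport.finite_inter_support_of_isCompact
          (hK'.image (f.iso.inv ≫ f.source.ι).continuous)
        refine ⟨U, U.isOpen.mem_nhds hz, ((hfin.preimage
          (f.iso.inv ≫ f.source.ι).isOpenEmbedding.injective.injOn).image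
            (Subtype.val : f.target → Y)).subset ?_⟩
        rintro y ⟨hyU, hy⟩
        by_cases h : y ∈ f.target
        · refine ⟨⟨y, h⟩, ⟨⟨⟨y, h⟩, hyU, rfl⟩, ?_⟩, rfl⟩
          rwa [Function.mem_support, dif_pos h] at hy
        · exact (hy (dif_neg h)).elim }
  property y hy := by
    by_cases h : y ∈ f.target
    · have h1 : D.1 ((f.iso.inv ≫ f.source.ι) ⟨y, h⟩) ≠ 0 := fun h0 ↦ hy (by
        simp only [Function.locallyFinsuppWithin.coe_mk]
        rw [dif_pos h, h0])
      have h2 := D.2 _ h1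
      have h3 := coheight_eq_of_isOpenImmersion (U := f.target.toScheme) (x := ⟨y, h⟩)
        (f.iso.inv ≫ f.source.ι)
      have h4 := coheight_eq_of_isOpenImmersion (U := f.target.toScheme) (x := ⟨y, h⟩)
        f.target.ι
      exact h4.trans (h3.symm.trans h2)
    · exact (hy (dif_neg h)).elim

end WeilDivisor

/-! ### The sheaf `𝒪_X(E)` of a Weil divisor -/

/-- The structure sheaf `𝒪_X` as a module over itself. -/
abbrev structureModule (X : Scheme.{u}) : X.Modules := SheafOfModules.unit X.ringCatSheaf

section DivisorialSheaf

variable {X : Scheme.{u}} [IsIntegral X]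

/-- The ring homomorphism sending a function on `U` to the corresponding constant function
`U → K(X)`. -/
def toConst (U : X.Opens) : Γ(X, U) →+* (U → X.functionField) :=
  RingHom.pi fun x ↦
    (algebraMap (X.presheaf.stalk x.1) X.functionField).comp (X.presheaf.germ U x.1 x.2).hom

theorem toConst_apply (U : X.Opens) [Nonempty U] (r : Γ(X, U)) (x : U) :
    toConst U r x = algebraMap Γ(X, U) X.functionField r :=
  Scheme.algebraMap_germ_eq_germToFunctionField X x.2 r

theorem toConst_map {U V : (Opens X)ᵒᵖ} (i : U ⟶ V) (r : Γ(X, U.unop)) (x : V.unop) :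
    toConst V.unop (X.presheaf.map i r) x = toConst U.unop r (i.unop x) := by
  simp only [toConst, RingHom.pi_apply, RingHom.comp_apply]
  congr 1
  exact X.presheaf.germ_res_apply i.unop x.1 x.2 r

variable [IsLocallyNoetherian X]

theorem ord_one (x : X) : Scheme.ord (1 : X.functionField) x = 0 := by
  have := Scheme.ord_mul (x := x) (one_ne_zero (α := X.functionField)) one_ne_zero
  rw [mul_one] at this
  omega

/-- The sections of `𝒪_X(E)` over `U`: rational functions `φ` with `φ = 0` or
`ord_x(φ) + E(x) ≥ 0` for every point `x ∈ U` of codimension one. They form a subsheaf of the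
constant sheaf `K(X)`, whose sections over `U` are the locally constant functions `U → K(X)`
(these are constant, unless `U` is empty). -/
def divisorPredicate (E : WeilDivisor X ℤ) :
    TopCat.LocalPredicate (X := X.toTopCat) fun _ ↦ X.functionField where
  pred {U} s := IsLocallyConstant s ∧
    ∀ x : U, coheight (α := X) x.1 = 1 → s x = 0 ∨ 0 ≤ Scheme.ord (s x) x.1 + E.1 x.1
  res {U V} i s hs := ⟨hs.1.comp_continuous (Opens.isOpenEmbedding_of_le i.le).continuous,
    fun x ↦ hs.2 (i x)⟩
  locality {U} s hs := by
    constructor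
    · rw [IsLocallyConstant.iff_exists_open]
      intro x
      obtain ⟨V, hxV, i, h, -⟩ := hs x
      obtain ⟨W, hW, hxW, h'⟩ := (IsLocallyConstant.iff_exists_open _).1 h ⟨x.1, hxV⟩
      refine ⟨i '' W, (Opens.isOpenEmbedding_of_le i.le).isOpenMap _ hW, ⟨_, hxW, rfl⟩, ?_⟩
      rintro _ ⟨y, hy, rfl⟩
      exact h' y hy
    · intro x hx
      obtain ⟨V, hxV, i, -, h⟩ := hs x
      exact h ⟨x.1, hxV⟩ hx

variable [IsNormalScheme X]

theorem isDiscreteValuationRing_stalk (x : X) (hx : coheight x = 1) :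
    IsDiscreteValuationRing (X.presheaf.stalk x) := by
  have h1 : ringKrullDim (X.presheaf.stalk x) = 1 := by
    rw [ringKrullDim_stalk_eq_coheight, hx]; rfl
  have hf : ¬ IsField (X.presheaf.stalk x) := fun h ↦ by
    have := ringKrullDim_eq_zero_of_isField h
    rw [h1] at this
    exact one_ne_zero this
  have : IsIntegrallyClosed (X.presheaf.stalk x) := IsNormalScheme.isIntegrallyClosed_stalk x
  have : Ring.DimensionLEOne (X.presheaf.stalk x) := by
    have := krullDimLE_of_coheight_le hx.le
    exact ⟨fun h0 hp ↦ Ring.krullDimLE_one_iff_of_noZeroDivisors.1 this _ h0 hp⟩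
  have : IsDedekindDomain (X.presheaf.stalk x) := { }
  exact ((IsDiscreteValuationRing.TFAE (X.presheaf.stalk x) hf).out 0 2).2 this

/-- The group of sections of `𝒪_X(E)` over `U`. -/
def divisorSections (E : WeilDivisor X ℤ) (U : X.Opens) : AddSubgroup (U → X.functionField) where
  carrier := {s | (divisorPredicate E).pred s}
  zero_mem' := ⟨IsLocallyConstant.const 0, fun _ _ ↦ Or.inl rfl⟩
  add_mem' {s t} hs ht := by
    refine ⟨hs.1.add ht.1, fun x hx ↦ ?_⟩
    have := isDiscreteValuationRing_stalk x.1 hx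
    rcases hs.2 x hx with h | h
    · simpa [h] using ht.2 x hx
    rcases ht.2 x hx with h' | h'
    · simpa [h'] using Or.inr h
    by_cases h0 : s x + t x = 0
    · exact Or.inl h0
    · have := Scheme.ord_add (x := x.1) h0
      right
      simp only [Pi.add_apply]
      omega
  neg_mem' {s} hs := by
    refine ⟨hs.1.neg, fun x hx ↦ ?_⟩
    rcases hs.2 x hx with h | h
    · left; simp [h]
    by_cases h0 : s x = 0
    · left; simp [h0]
    right
    have h1 : Scheme.ord (-1 : X.functionField) x.1 = 0 := by
      have := Scheme.ord_mul (x := x.1) (neg_ne_zero.2 (one_ne_zero (α := X.functionField)))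
        (neg_ne_zero.2 (one_ne_zero (α := X.functionField)))
      rw [neg_mul_neg, mul_one, ord_one] at this
      omega
    have h2 := Scheme.ord_mul (x := x.1) (neg_ne_zero.2 (one_ne_zero (α := X.functionField))) h0
    rw [neg_one_mul, h1, zero_add] at h2
    rw [Pi.neg_apply, h2]
    exact h

/-- `𝒪_X(E)(U)` is closed under multiplication by functions on `U`. -/
theorem toConst_mul_mem (E : WeilDivisor X ℤ) (U : X.Opens) (r : Γ(X, U))
    {s : U → X.functionField} (hs : s ∈ divisorSections E U) :
    toConst U r * s ∈ divisorSections E U := by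
  have hc : IsLocallyConstant (toConst U r) := by
    rcases isEmpty_or_nonempty U with h | h
    · exact IsLocallyConstant.of_constant _ fun x ↦ h.elim x
    · exact IsLocallyConstant.of_constant _ fun x y ↦ by rw [toConst_apply, toConst_apply]
  refine ⟨hc.mul hs.1, fun x hx ↦ ?_⟩
  have : Nonempty U := ⟨x⟩
  rcases hs.2 x hx with h | h
  · left; simp [h]
  by_cases hr : r = 0
  · left; simp [hr]
  right
  have := Scheme.ord_le_smul x.2 hr (s x)
  rw [Algebra.smul_def, ← toConst_apply U r x] at this
  exact h.trans (by simpa using this)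

/-- Functions on `U` act on `𝒪_X(E)(U)` by multiplication in `K(X)`. -/
instance (E : WeilDivisor X ℤ) (U : X.Opens) : Module Γ(X, U) (divisorSections E U) where
  smul r s := ⟨toConst U r * s.1, toConst_mul_mem E U r s.2⟩
  one_smul s := Subtype.ext (by change toConst U 1 * s.1 = s.1; rw [map_one, one_mul])
  mul_smul a b s := Subtype.ext (by
    change toConst U (a * b) * s.1 = toConst U a * (toConst U b * s.1)
    rw [map_mul, mul_assoc])
  smul_zero a := Subtype.ext (mul_zero _)
  smul_add a s t := Subtype.ext (mul_add _ _ _)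
  add_smul a b s := Subtype.ext (by
    change toConst U (a + b) * s.1 = toConst U a * s.1 + toConst U b * s.1
    rw [map_add, add_mul])
  zero_smul s := Subtype.ext (by change toConst U 0 * s.1 = 0; rw [map_zero, zero_mul])

/-- The presheaf of abelian groups underlying `𝒪_X(E)`, with the restriction of functions. -/
def divisorPresheaf (E : WeilDivisor X ℤ) : TopCat.Presheaf Ab.{u} X.toTopCat where
  obj U := AddCommGrpCat.of (divisorSections E U.unop)
  map i := AddCommGrpCat.ofHom
    { toFun s := ⟨fun x ↦ s.1 (i.unop x), (divisorPredicate E).res i.unop s.1 s.2⟩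
      map_zero' := rfl
      map_add' _ _ := rfl }

instance (E : WeilDivisor X ℤ) (U : (Opens X)ᵒᵖ) :
    Module (X.ringCatSheaf.obj.obj U) ((divisorPresheaf E).obj U) :=
  inferInstanceAs (Module Γ(X, U.unop) (divisorSections E U.unop))

/-- The sheaf of `𝒪_X`-modules `𝒪_X(E)` of a Weil divisor `E` on a normal scheme. -/
def divisorSheaf (E : WeilDivisor X ℤ) : X.Modules where
  val := .ofPresheaf (R := X.ringCatSheaf.obj) (divisorPresheaf E) fun U V i r s ↦ by
    apply Subtype.ext
    funext x
    exact congrArg (· * s.1 (i.unop x)) (toConst_map i r x).symm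
  isSheaf := (TopCat.Presheaf.isSheaf_iff_isSheaf_comp (forget Ab) _).2
    (TopCat.subsheafToTypes (divisorPredicate E)).2

/-- For effective `E`, the section `1` of `𝒪_X(E)`. -/
def oneSection (E : WeilDivisor X ℤ) (hE : 0 ≤ E) : (divisorSheaf E).val.sections :=
  PresheafOfModules.sectionsMk (M := (divisorSheaf E).val)
    (fun U ↦ (⟨fun _ ↦ 1, IsLocallyConstant.const 1, fun x _ ↦ Or.inr (by
      rw [ord_one, zero_add]
      exact hE x.1)⟩ : divisorSections E U.unop)) fun _ _ _ ↦ rfl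

/-- For effective `E`, the inclusion `𝒪_X ⟶ 𝒪_X(E)`, which sends `1` to `1`. -/
def structureModuleToDivisorSheaf (E : WeilDivisor X ℤ) (hE : 0 ≤ E) :
    structureModule X ⟶ divisorSheaf E :=
  (SheafOfModules.unitHomEquiv (divisorSheaf E)).symm (oneSection E hE)

end DivisorialSheaf

/-! ### Globally `+`-regular pairs -/

theorem WeilDivisor.floor_pullback_nonneg {X Y : Scheme.{u}} (f : Y ⟶ X) [IsFinite f]
    {Δ : WeilDivisor X ℚ} (hΔ : 0 ≤ Δ) : 0 ≤ WeilDivisor.floor (WeilDivisor.pullback f Δ) := by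
  intro y
  change (0 : ℤ) ≤ ⌊if coheight y = 1 then (ramificationIndex f y : ℚ) * Δ.1 (f y) else 0⌋
  rw [Int.floor_nonneg]
  split_ifs
  · exact mul_nonneg (Nat.cast_nonneg _) (hΔ (f y))
  · exact le_rfl

/-- The natural map `𝒪_X ⟶ f_* 𝒪_Y ⟶ f_* 𝒪_Y(⌊f^* Δ⌋)` for an effective `ℚ`-divisor `Δ` on `X`
and a finite morphism `f : Y ⟶ X` from a normal integral scheme. -/
def plusMap {X Y : Scheme.{u}} [IsIntegral Y] [IsLocallyNoetherian Y] [IsNormalScheme Y]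
    (f : Y ⟶ X) [IsFinite f] (Δ : WeilDivisor X ℚ) (hΔ : 0 ≤ Δ) :
    structureModule X ⟶ (Scheme.Modules.pushforward f).obj
      (divisorSheaf (WeilDivisor.floor (WeilDivisor.pullback f Δ))) :=
  SheafOfModules.unitToPushforwardObjUnit f.toRingCatSheafHom ≫
    (Scheme.Modules.pushforward f).map
      (structureModuleToDivisorSheaf _ (WeilDivisor.floor_pullback_nonneg f hΔ))

/-- `(X, Δ)` is *globally `+`-regular*: `Δ` is effective, and for every finite dominant morphism
`f : Y ⟶ X` from a normal integral scheme, `𝒪_X ⟶ f_* 𝒪_Y(⌊f^* Δ⌋)` splits as a map of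
`𝒪_X`-modules. (`Y` is automatically locally Noetherian when `X` is.) -/
def IsGloballyPlusRegular (X : Scheme.{u}) (Δ : WeilDivisor X ℚ) : Prop :=
  ∃ hΔ : 0 ≤ Δ, ∀ (Y : Scheme.{u}) [IsIntegral Y] [IsLocallyNoetherian Y] [IsNormalScheme Y]
    (f : Y ⟶ X) [IsFinite f] [IsDominant f], IsSplitMono (plusMap f Δ hΔ)

/-- `(X, Δ)` is *strongly globally `+`-regular*: for every effective (integral) Weil divisor `D`
there is a rational `ε > 0` such that `(X, Δ + ε D)` is globally `+`-regular. -/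
def IsStronglyGloballyPlusRegular (X : Scheme.{u}) (Δ : WeilDivisor X ℚ) : Prop :=
  ∀ D : WeilDivisor X ℤ, 0 ≤ D →
    ∃ ε : ℚ, 0 < ε ∧ IsGloballyPlusRegular X (Δ + WeilDivisor.ratSMul ε D)

/-- A birational map, given as an isomorphism between dense open subschemes of `X` and `Y`, is
*small* if the complements of these open subschemes have codimension at least two. -/
def IsSmall {X Y : Scheme.{u}} (f : X.PartialIso Y) : Prop :=
  (∀ x : X, x ∉ f.source → 2 ≤ coheight x) ∧ ∀ y : Y, y ∉ f.target → 2 ≤ coheight y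

end PlusRegular

end

/-! Splitting is a matter of function fields and points of codimension one. By
`isSplitMono_plusMap_iff_exists_isDivisorRetraction`, a splitting for `f : Y ⟶ X` amounts to a
`K(X)`-linear map `K(Y) → K(X)` that fixes `1` and sends sections of the divisorial sheaf to
functions regular in codimension one; Hartogs on the normal base supplies regularity everywhere
else.

Given `D` on `Y`, let `D'` be its strict transform on `X`, and take the `ε` that works for `D'`. A
finite cover `g : T ⟶ Y` restricts to a finite cover `Q` of the common open subscheme `Z`. Let `S`
be the normalization of `X` in `Q`. It is normal, it is finite over `X` because `X` is Nagata
(`isFinite_fromNormalization`), and it contains `Q` as exactly the part over `Z`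
(`mem_range_of_isFinite_comp`). The hypothesis splits `S ⟶ X`.

Since `K(S) = K(Q) = K(T)` and `K(X) = K(Z) = K(Y)`, the retraction can be read on `Y`. The rounded
pullbacks agree on `Q`, and `Z` contains all points of codimension one of `Y`, so it remains a
retraction there (`exists_isDivisorRetraction_of_isOpenImmersion`). -/

/-! ### Commutative algebra: Hartogs for normal domains, invariance of orders. -/

/-- If `x` is not in `A`, a maximal denominator ideal of a multiple of `x` outside `A` is a prime of
height one, and the hypothesis at that prime is contradictory. -/
theorem exists_algebraMap_eq_of_forall_height_eq_one {A K : Type*} [CommRing A] [IsDomain A]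
    [IsNoetherianRing A] [IsIntegrallyClosed A] [Field K] [Algebra A K] [IsFractionRing A K]
    (x : K) (h : ∀ p : Ideal A, p.IsPrime → p.height = 1 →
      ∃ s ∉ p, algebraMap A K s * x ∈ (algebraMap A K).range) :
    x ∈ (algebraMap A K).range := by
  by_contra hx
  let I (y : K) : Ideal A := Submodule.comap (LinearMap.toSpanSingleton A K y)
    (LinearMap.range (Algebra.linearMap A K))
  have hI (y : K) (a : A) : a ∈ I y ↔ algebraMap A K a * y ∈ (algebraMap A K).range := by
    simp [I, Algebra.smul_def]
  obtain ⟨p, ⟨c, hc, rfl⟩, hmax⟩ := set_has_maximal_iff_noetherian.2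
    (inferInstanceAs (IsNoetherian A A))
    {J | ∃ c : A, algebraMap A K c * x ∉ (algebraMap A K).range ∧ I (algebraMap A K c * x) = J}
    ⟨_, 1, by simpa using hx, rfl⟩
  set y := algebraMap A K c * x with hy
  -- If `a ∉ I y`, then `a * y` is again a multiple of `x` outside `A`, so maximality gives `I (a *
  -- y) = I y`.
  have hp : (I y).IsPrime := by
    refine ⟨fun htop ↦ hc ?_, fun {a b} hab ↦ or_iff_not_imp_left.2 fun ha ↦ ?_⟩
    · have := (Ideal.eq_top_iff_one _).1 htop
      rwa [hI, map_one, one_mul] at this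
    · rw [hI] at ha hab
      have hle : I y ≤ I (algebraMap A K (a * c) * x) := fun r hr ↦ by
        rw [hI] at hr ⊢
        obtain ⟨z, hz⟩ := hr
        exact ⟨a * z, by rw [map_mul, hz, map_mul, hy]; ring⟩
      have hnot := hmax (I (algebraMap A K (a * c) * x)) ⟨a * c, by
        rwa [map_mul, mul_assoc], rfl⟩
      have hb : b ∈ I (algebraMap A K (a * c) * x) := by
        rw [hI]
        obtain ⟨z, hz⟩ := hab
        exact ⟨z, by rw [hz, map_mul, map_mul, hy]; ring⟩
      by_contra hb'
      exact hnot (lt_of_le_of_ne hle fun he ↦ hb' (he ▸ hb))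
  have hne : I y ≠ ⊥ := by
    obtain ⟨a, b, hb, hab⟩ := IsFractionRing.div_surjective (A := A) y
    have hb0 : b ≠ 0 := nonZeroDivisors.ne_zero hb
    refine fun h0 ↦ hb0 ?_
    rw [← Ideal.mem_bot, ← h0, hI]
    refine ⟨a, ?_⟩
    rw [← hab, mul_div_cancel₀]
    simpa using hb0
  -- Otherwise `y` maps the nonzero finitely generated ideal `I y` into itself, so it is integral
  -- over `A` and hence lies in `A`.
  obtain ⟨t, ht, w, hw, htw⟩ : ∃ t ∈ I y, ∃ w ∉ I y, algebraMap A K w = algebraMap A K t * y := by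
    by_contra! hcon
    refine hc ?_
    have : IsIntegral A y := by
      refine isIntegral_of_smul_mem_submodule
        (Submodule.map (Algebra.linearMap A K) (I y)) ?_ ((IsNoetherian.noetherian (I y)).map _) y ?_
      · exact fun h ↦ hne (Submodule.map_injective_of_injective
          (f := Algebra.linearMap A K) (IsFractionRing.injective A K) (h.trans (Submodule.map_bot _).symm))
      · rintro _ ⟨a, ha, rfl⟩
        obtain ⟨w, hw⟩ := (hI y a).1 ha
        refine ⟨w, by_contra fun h ↦ hcon a ha w h hw, ?_⟩
        simp [hw, mul_comm]
    exact IsIntegrallyClosed.isIntegral_iff.1 this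
  -- For `a ∈ I y` with `z = a * y`, the identity `a * w = t * z` puts `a` in any prime between `t`
  -- and `I y`, as `w ∉ I y`. Krull's principal ideal theorem then bounds the height.
  have hmin : I y ∈ (Ideal.span {t}).minimalPrimes := by
    refine ⟨⟨hp, (Ideal.span_singleton_le_iff_mem _).2 ht⟩, fun q ⟨hq, htq⟩ hle a ha ↦ ?_⟩
    obtain ⟨z, hz⟩ := (hI y a).1 ha
    have : a * w = t * z := IsFractionRing.injective A K (by
      rw [map_mul, map_mul, htw, hz]; ring)
    refine (hq.mem_or_mem (x := a) (y := w) ?_).resolve_right fun h ↦ hw (hle h)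
    rw [this]
    exact q.mul_mem_right _ ((Ideal.span_singleton_le_iff_mem _).1 htq)
  have hheight : (I y).height = 1 := by
    refine le_antisymm (Ideal.height_le_one_of_isPrincipal_of_mem_minimalPrimes _ _ hmin) ?_
    rw [Order.one_le_iff_ne_zero]
    exact fun h0 ↦ hne (Ideal.height_eq_zero_iff_eq_bot.1 h0)
  obtain ⟨s, hs, z, hz⟩ := h _ hp hheight
  exact hs ((hI _ _).2 ⟨c * z, by rw [map_mul, hz, hy]; ring⟩)

/-- Orders of vanishing and ramification indices are both lengths of quotients of local rings; this
gives the invariance of both. -/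
theorem Module.length_quotient_map_ringEquiv {R S : Type*} [CommRing R] [CommRing S] (e : R ≃+* S)
    (I : Ideal R) :
    Module.length S (S ⧸ I.map (e : R →+* S)) = Module.length R (R ⧸ I) := by
  algebraize [(e : R →+* S)]
  rw [← Module.length_eq_of_surjective (R := S) (S := R) (M := S ⧸ I.map (e : R →+* S))
    e.surjective]
  let f : R ≃ₐ[R] S := AlgEquiv.ofRingEquiv (f := e) fun _ ↦ rfl
  exact (Ideal.quotientEquivAlg I (I.map (e : R →+* S)) f rfl).toLinearEquiv.length_eq.symm

theorem Ring.ordMonoidWithZeroHom_ringEquiv {R S : Type*} [CommRing R] [IsNoetherianRing R]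
    [Ring.KrullDimLE 1 R] [IsDomain R] [CommRing S] [IsNoetherianRing S] [Ring.KrullDimLE 1 S]
    [IsDomain S] (e : R ≃+* S) (x : R) :
    Ring.ordMonoidWithZeroHom S (e x) = Ring.ordMonoidWithZeroHom R x := by
  by_cases hx : x = 0
  · simp [hx]
  have h : Ring.ord S (e x) = Ring.ord R x := by
    rw [Ring.ord, Ring.ord, ← Module.length_quotient_map_ringEquiv e, Ideal.map_span, RingEquiv.coe_toRingHom,
      Set.image_singleton]
  rw [Ring.ordMonoidWithZeroHom_eq_ord, Ring.ordMonoidWithZeroHom_eq_ord, h]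
  · simpa
  · simpa

theorem Ring.ordFrac_map_ringEquiv {R S : Type*} [CommRing R] [IsNoetherianRing R]
    [Ring.KrullDimLE 1 R] [IsDomain R] [CommRing S] [IsNoetherianRing S] [Ring.KrullDimLE 1 S]
    [IsDomain S] {K L : Type*} [Field K] [Field L] [Algebra R K] [IsFractionRing R K]
    [Algebra S L] [IsFractionRing S L] (e : R ≃+* S) (σ : K →+* L)
    (h : ∀ r, σ (algebraMap R K r) = algebraMap S L (e r)) (x : K) :
    Ring.ordFrac S (σ x) = Ring.ordFrac R x := by
  obtain ⟨a, b, hb, rfl⟩ := IsFractionRing.div_surjective (A := R) x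
  have hb0 : b ≠ 0 := nonZeroDivisors.ne_zero hb
  by_cases ha : a = 0
  · simp [ha]
  rw [map_div₀, map_div₀, map_div₀, h, h, Ring.ordFrac_eq_ord, Ring.ordFrac_eq_ord,
    Ring.ordFrac_eq_ord, Ring.ordFrac_eq_ord, Ring.ordMonoidWithZeroHom_ringEquiv,
    Ring.ordMonoidWithZeroHom_ringEquiv]
  all_goals simpa

noncomputable section

namespace PlusRegular

/-! ### Function fields, and orders along open immersions. -/

section FunctionField

variable {X Y Z : Scheme.{u}} [IsIntegral X] [IsIntegral Y] [IsIntegral Z]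

theorem map_genericPoint (f : Y ⟶ X) [IsDominant f] : f (genericPoint Y) = genericPoint X := by
  refine ((genericPoint_spec Y).image f.continuous).eq ?_
  rw [Set.image_univ, f.denseRange.closure_range]
  exact genericPoint_spec X

theorem isDominant_of_isOpenImmersion (f : Y ⟶ X) [IsOpenImmersion f] : IsDominant f :=
  ⟨f.isOpenEmbedding.isOpen_range.dense ⟨_, Set.mem_range_self (genericPoint Y)⟩⟩

theorem nonempty_preimage (f : Y ⟶ X) [IsDominant f] (U : X.Opens) [hU : Nonempty U] :
    Nonempty (f ⁻¹ᵁ U) := by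
  refine ⟨⟨genericPoint Y, ?_⟩⟩
  change f _ ∈ U
  rw [map_genericPoint]
  exact ((genericPoint_spec X).mem_open_set_iff U.isOpen).2 (by simpa using hU)

/-- The extension of function fields induced by a dominant morphism of integral schemes. -/
def functionFieldMap (f : Y ⟶ X) [IsDominant f] : X.functionField →+* Y.functionField :=
  (X.presheaf.stalkSpecializes (specializes_of_eq (map_genericPoint f)) ≫
    f.stalkMap (genericPoint Y)).hom

theorem functionFieldMap_algebraMap (f : Y ⟶ X) [IsDominant f] (y : Y)
    (s : X.presheaf.stalk (f y)) :
    functionFieldMap f (algebraMap _ _ s) =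
      algebraMap (Y.presheaf.stalk y) Y.functionField (f.stalkMap y s) := by
  have h : X.presheaf.stalkSpecializes ((genericPoint_spec X).specializes (Set.mem_univ (f y))) ≫
      X.presheaf.stalkSpecializes (specializes_of_eq (map_genericPoint f)) ≫
        f.stalkMap (genericPoint Y) =
      f.stalkMap y ≫
        Y.presheaf.stalkSpecializes ((genericPoint_spec Y).specializes (Set.mem_univ y)) := by
    rw [TopCat.Presheaf.stalkSpecializes_comp_assoc, ← Scheme.Hom.stalkSpecializes_stalkMap]
  exact congr($(h).hom s)

theorem functionFieldMap_germToFunctionField (f : Y ⟶ X) [IsDominant f] (U : X.Opens)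
    [Nonempty U] [Nonempty (f ⁻¹ᵁ U)] (s : Γ(X, U)) :
    functionFieldMap f (X.germToFunctionField U s) =
      Y.germToFunctionField (f ⁻¹ᵁ U) (f.app U s) := by
  obtain ⟨y, hy⟩ := ‹Nonempty (f ⁻¹ᵁ U)›
  rw [← Scheme.algebraMap_germ_eq_germToFunctionField X (x := f y) hy s,
    functionFieldMap_algebraMap]
  exact (congrArg _ (f.germ_stalkMap_apply U y hy s)).trans
    (Scheme.algebraMap_germ_eq_germToFunctionField Y hy _)

theorem functionFieldMap_comp (f : Y ⟶ X) (g : Z ⟶ Y) [IsDominant f] [IsDominant g]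
    [IsDominant (g ≫ f)] (x : X.functionField) :
    functionFieldMap (g ≫ f) x = functionFieldMap g (functionFieldMap f x) := by
  obtain ⟨U, hU, s, rfl⟩ := X.presheaf.exists_germ_eq x
  have hY : genericPoint Y ∈ f ⁻¹ᵁ U := by
    change f _ ∈ U
    rwa [map_genericPoint]
  have hZ : genericPoint Z ∈ g ⁻¹ᵁ f ⁻¹ᵁ U := by
    change g _ ∈ f ⁻¹ᵁ U
    rwa [map_genericPoint]
  have : Nonempty U := ⟨⟨_, hU⟩⟩
  have : Nonempty (f ⁻¹ᵁ U) := ⟨⟨_, hY⟩⟩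
  have : Nonempty (g ⁻¹ᵁ f ⁻¹ᵁ U) := ⟨⟨_, hZ⟩⟩
  have : Nonempty ((g ≫ f) ⁻¹ᵁ U) := ⟨⟨_, hZ⟩⟩
  change functionFieldMap (g ≫ f) (X.germToFunctionField U s) =
    functionFieldMap g (functionFieldMap f (X.germToFunctionField U s))
  rw [functionFieldMap_germToFunctionField, functionFieldMap_germToFunctionField,
    functionFieldMap_germToFunctionField]
  simp
  rfl

theorem functionFieldMap_congr {f g : Y ⟶ X} [IsDominant f] [IsDominant g] (h : f = g)
    (x : X.functionField) : functionFieldMap f x = functionFieldMap g x := by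
  subst h
  rfl

theorem functionFieldMap_bijective (f : Y ⟶ X) [IsOpenImmersion f] [IsDominant f] :
    Function.Bijective (functionFieldMap f) := by
  have : IsIso (X.presheaf.stalkSpecializes (specializes_of_eq (map_genericPoint f))) :=
    (X.presheaf.stalkCongr (.of_eq (map_genericPoint f))).isIso_inv
  exact ConcreteCategory.bijective_of_isIso (X.presheaf.stalkSpecializes
    (specializes_of_eq (map_genericPoint f)) ≫ f.stalkMap (genericPoint Y))

theorem functionFieldMap_mem_range_iff (f : Y ⟶ X) [IsOpenImmersion f] [IsDominant f] (y : Y)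
    (x : X.functionField) :
    functionFieldMap f x ∈ (algebraMap (Y.presheaf.stalk y) Y.functionField).range ↔
      x ∈ (algebraMap (X.presheaf.stalk (f y)) X.functionField).range := by
  constructor
  · rintro ⟨s, hs⟩
    obtain ⟨t, rfl⟩ := (ConcreteCategory.bijective_of_isIso (f.stalkMap y)).2 s
    refine ⟨t, (functionFieldMap f).injective ?_⟩
    rw [functionFieldMap_algebraMap, hs]
  · rintro ⟨t, rfl⟩
    exact ⟨_, (functionFieldMap_algebraMap f y t).symm⟩

theorem ord_functionFieldMap [IsLocallyNoetherian X] [IsLocallyNoetherian Y] (f : Y ⟶ X)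
    [IsOpenImmersion f] [IsDominant f] (x : X.functionField) (y : Y) :
    Scheme.ord (functionFieldMap f x) y = Scheme.ord x (f y) := by
  by_cases hy : coheight y = 1
  swap
  -- Outside codimension one the order is zero by convention.
  · rw [Scheme.ord_eq_zero_of_coheight_neq_one hy, Scheme.ord_eq_zero_of_coheight_neq_one]
    rwa [coheight_eq_of_isOpenImmersion]
  have hx : coheight (f y) = 1 := by rwa [coheight_eq_of_isOpenImmersion]
  have := krullDimLE_of_coheight_le hy.le
  have := krullDimLE_of_coheight_le hx.le
  rw [Scheme.ord_eq_ordHom_of_coheight_eq_one hy, Scheme.ord_eq_ordHom_of_coheight_eq_one hx,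
    Scheme.ordHom, Scheme.ordHom]
  rw [Ring.ordFrac_map_ringEquiv (asIso (f.stalkMap y)).commRingCatIsoToRingEquiv]
  exact fun r ↦ functionFieldMap_algebraMap f y r

end FunctionField

/-! ### Ramification indices along open immersions. -/

section Ramification

variable {X Y Z : Scheme.{u}}

theorem ramificationIndex_comp_of_isOpenImmersion_left (j : Z ⟶ Y) [IsOpenImmersion j] (f : Y ⟶ X)
    (z : Z) : WeilDivisor.ramificationIndex (j ≫ f) z = WeilDivisor.ramificationIndex f (j z) := by
  let e := (asIso (j.stalkMap z)).commRingCatIsoToRingEquiv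
  rw [WeilDivisor.ramificationIndex, WeilDivisor.ramificationIndex,
    ← Module.length_quotient_map_ringEquiv e, Ideal.map_map, Scheme.Hom.stalkMap_comp]
  rfl

theorem ramificationIndex_comp_of_isOpenImmersion_right (f : Z ⟶ Y) (j : Y ⟶ X)
    [IsOpenImmersion j] (z : Z) :
    WeilDivisor.ramificationIndex (f ≫ j) z = WeilDivisor.ramificationIndex f z := by
  let e := (asIso (j.stalkMap (f z))).commRingCatIsoToRingEquiv
  have h : (IsLocalRing.maximalIdeal (X.presheaf.stalk (j (f z)))).map (j.stalkMap (f z)).hom =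
      IsLocalRing.maximalIdeal (Y.presheaf.stalk (f z)) :=
    IsLocalRing.map_ringEquiv_maximalIdeal e
  rw [WeilDivisor.ramificationIndex, WeilDivisor.ramificationIndex, ← h, Ideal.map_map,
    Scheme.Hom.stalkMap_comp]
  rfl

end Ramification

/-! ### Hartogs on normal schemes. -/

section Hartogs

variable {X : Scheme.{u}} [IsIntegral X]

/-- Local representatives of `x` agree on overlaps, because a section on an integral scheme is
determined by its germ at the generic point; hence they glue. -/
theorem exists_germToFunctionField_eq (U : X.Opens) [Nonempty U] (x : X.functionField)
    (h : ∀ y ∈ U, x ∈ (algebraMap (X.presheaf.stalk y) X.functionField).range) :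
    ∃ s : Γ(X, U), X.germToFunctionField U s = x := by
  have h1 (y : U) : ∃ (V : X.Opens) (_ : y.1 ∈ V) (_ : V ≤ U) (hV : Nonempty V) (s : Γ(X, V)),
      X.germToFunctionField V s = x := by
    obtain ⟨t, ht⟩ := h y y.2
    obtain ⟨V, hV, s, rfl⟩ := X.presheaf.exists_germ_eq t
    have : Nonempty V := ⟨⟨_, hV⟩⟩
    have : Nonempty ↥(V ⊓ U) := ⟨⟨_, hV, y.2⟩⟩
    refine ⟨V ⊓ U, ⟨hV, y.2⟩, inf_le_right, this, X.presheaf.map (homOfLE inf_le_left).op s, ?_⟩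
    rw [← ht, Scheme.algebraMap_germ_eq_germToFunctionField]
    exact X.presheaf.germ_res_apply _ _ _ _
  choose V hyV hVU hV s hs using h1
  obtain ⟨t, ht, -⟩ := X.sheaf.existsUnique_gluing' V U (fun y ↦ homOfLE (hVU y))
    (fun y hy ↦ Opens.mem_iSup.2 ⟨⟨y, hy⟩, hyV _⟩) s fun i j ↦ by
      have hV' (k : U) : genericPoint X ∈ V k :=
        ((genericPoint_spec X).mem_open_set_iff (V k).isOpen).2 (by simpa using hV k)
      have hij : genericPoint X ∈ V i ⊓ V j := ⟨hV' i, hV' j⟩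
      refine germ_injective_of_isIntegral X (genericPoint X) hij ?_
      exact (X.presheaf.germ_res_apply _ _ _ _).trans
        (((hs i).trans (hs j).symm).trans (X.presheaf.germ_res_apply _ _ _ _).symm)
  obtain ⟨y⟩ := ‹Nonempty U›
  refine ⟨t, ?_⟩
  rw [← hs y, ← ht y]
  exact (X.presheaf.germ_res_apply _ _ _ _).symm

theorem mem_range_germToFunctionField_of_isIntegral [IsNormalScheme X] (U : X.Opens) [Nonempty U]
    {x : X.functionField} (hx : IsIntegral Γ(X, U) x) :
    ∃ s : Γ(X, U), X.germToFunctionField U s = x := by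
  refine exists_germToFunctionField_eq U x fun y hy ↦ ?_
  have := IsNormalScheme.isIntegrallyClosed_stalk y
  let := X.presheaf.algebra_section_stalk (U := U) ⟨y, hy⟩
  have : IsScalarTower Γ(X, U) (X.presheaf.stalk y) X.functionField :=
    functionField_isScalarTower X U ⟨y, hy⟩
  exact IsIntegrallyClosed.isIntegral_iff.1 (hx.tower_top (A := X.presheaf.stalk y))

/-- `U` need not be affine: the normalization argument uses this for preimages under a morphism that
is not assumed affine. -/
theorem isIntegrallyClosed_sections [IsNormalScheme X] (U : X.Opens) [Nonempty U] :
    IsIntegrallyClosed Γ(X, U) := by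
  have hinj := X.germToFunctionField_injective U
  have : FaithfulSMul Γ(X, U) X.functionField := (faithfulSMul_iff_algebraMap_injective _ _).2 hinj
  have : IsIntegrallyClosedIn Γ(X, U) X.functionField :=
    (isIntegrallyClosedIn_iff).2
      ⟨hinj, fun hx ↦ mem_range_germToFunctionField_of_isIntegral U hx⟩
  exact .of_isIntegrallyClosedIn Γ(X, U) X.functionField

/-- On an affine neighbourhood of `y` inside `U`, primes of height one are points of codimension
one, so algebraic Hartogs applies. -/
theorem mem_range_stalk_of_forall_coheight_eq_one [IsLocallyNoetherian X] [IsNormalScheme X]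
    (U : X.Opens) (x : X.functionField) (h : ∀ z ∈ U, coheight z = 1 →
      x ∈ (algebraMap (X.presheaf.stalk z) X.functionField).range) (y : X) (hy : y ∈ U) :
    x ∈ (algebraMap (X.presheaf.stalk y) X.functionField).range := by
  obtain ⟨_, ⟨W, hW, rfl⟩, hyW, hWU⟩ := X.isBasis_affineOpens.exists_subset_of_mem_open hy U.isOpen
  replace hW : IsAffineOpen W := hW
  have : Nonempty W := ⟨⟨y, hyW⟩⟩
  have := isIntegrallyClosed_sections W
  have := functionField_isFractionRing_of_isAffineOpen X W hW
  have : IsNoetherianRing Γ(X, W) := IsLocallyNoetherian.component_noetherian ⟨W, hW⟩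
  obtain ⟨s, rfl⟩ := exists_algebraMap_eq_of_forall_height_eq_one (A := Γ(X, W)) x
    fun p hp hp1 ↦ by
      let P : PrimeSpectrum Γ(X, W) := ⟨p, hp⟩
      have hz : hW.fromSpec P ∈ W := by
        have : hW.fromSpec P ∈ Set.range hW.fromSpec := ⟨P, rfl⟩
        rwa [hW.range_fromSpec] at this
      let := X.presheaf.algebra_section_stalk (U := W) ⟨_, hz⟩
      have : IsScalarTower Γ(X, W) (X.presheaf.stalk (hW.fromSpec P)) X.functionField :=
        functionField_isScalarTower X W ⟨_, hz⟩
      have hloc : IsLocalization.AtPrime (X.presheaf.stalk (hW.fromSpec P)) p :=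
        hW.isLocalization_stalk' P hz
      have hcoh : coheight (hW.fromSpec P) = 1 := by
        exact (coheight_eq_of_isOpenImmersion hW.fromSpec).trans
          ((idealHeight_eq_coheight Γ(X, W) P).symm.trans hp1)
      obtain ⟨t, rfl⟩ := h _ (hWU hz) hcoh
      obtain ⟨⟨a, b⟩, hab⟩ := IsLocalization.surj p.primeCompl t
      refine ⟨b, b.2, a, ?_⟩
      rw [mul_comm, IsScalarTower.algebraMap_apply Γ(X, W) (X.presheaf.stalk (hW.fromSpec P)),
        IsScalarTower.algebraMap_apply Γ(X, W) (X.presheaf.stalk (hW.fromSpec P))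
          X.functionField b, ← map_mul, hab]
  exact ⟨X.presheaf.germ W y hyW s, Scheme.algebraMap_germ_eq_germToFunctionField X hyW s⟩

theorem exists_germToFunctionField_eq_of_forall_coheight_eq_one [IsLocallyNoetherian X]
    [IsNormalScheme X] (U : X.Opens) [Nonempty U] (x : X.functionField)
    (h : ∀ z ∈ U, coheight z = 1 →
      x ∈ (algebraMap (X.presheaf.stalk z) X.functionField).range) :
    ∃ s : Γ(X, U), X.germToFunctionField U s = x :=
  exists_germToFunctionField_eq U x (mem_range_stalk_of_forall_coheight_eq_one U x h)

end Hartogs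

/-! ### Splittings as retractions of function fields. -/

section DivisorSection

variable {Y : Scheme.{u}} [IsIntegral Y] [IsLocallyNoetherian Y]

/-- The rational function `φ` is a section of `𝒪_Y(E)` over `U`. -/
def IsDivisorSection (E : WeilDivisor Y ℤ) (U : Y.Opens) (φ : Y.functionField) : Prop :=
  ∀ y ∈ U, coheight y = 1 → φ = 0 ∨ 0 ≤ Scheme.ord φ y + E.1 y

theorem isDivisorSection_germToFunctionField (E : WeilDivisor Y ℤ) (hE : 0 ≤ E) (U : Y.Opens)
    [Nonempty U] (b : Γ(Y, U)) : IsDivisorSection E U (Y.germToFunctionField U b) := by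
  intro y hy hy1
  by_cases hb : b = 0
  · left
    rw [hb, _root_.map_zero]
  · right
    have h := Scheme.ord_le_smul hy hb 1
    rw [ord_one, Algebra.smul_def, mul_one] at h
    exact add_nonneg h (hE y)

end DivisorSection

section Retraction

variable {X Y : Scheme.{u}} [IsIntegral Y] [IsLocallyNoetherian Y] [IsNormalScheme Y]

/-- The section `1` of `𝒪_Y(E)` over `U`. -/
def oneDivisorSection (E : WeilDivisor Y ℤ) (hE : 0 ≤ E) (U : Y.Opens) : divisorSections E U :=
  ⟨fun _ ↦ 1, IsLocallyConstant.const 1, fun x _ ↦ Or.inr (by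
      rw [ord_one, zero_add]
      exact hE x.1)⟩

/-- The restriction of sections of `𝒪_Y(E)`. -/
def resDivisorSection (E : WeilDivisor Y ℤ) {U V : Y.Opens} (h : U ≤ V)
    (s : divisorSections E V) : divisorSections E U :=
  (divisorPresheaf E).map (homOfLE h).op s

theorem plusMap_one (f : Y ⟶ X) [IsFinite f] (Δ : WeilDivisor X ℚ) (hΔ : 0 ≤ Δ) (U : X.Opens) :
    (plusMap f Δ hΔ).val.app (.op U) (1 : Γ(X, U)) =
      oneDivisorSection _ (WeilDivisor.floor_pullback_nonneg f hΔ) (f ⁻¹ᵁ U) := by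
  have h1 : (SheafOfModules.unitToPushforwardObjUnit f.toRingCatSheafHom).val.app (.op U)
      (1 : Γ(X, U)) = (1 : Γ(Y, f ⁻¹ᵁ U)) := by
    exact map_one (f.app U).hom
  have h2 : (structureModuleToDivisorSheaf _ (WeilDivisor.floor_pullback_nonneg f hΔ)).val.app
      (.op (f ⁻¹ᵁ U)) (1 : Γ(Y, f ⁻¹ᵁ U)) =
        oneDivisorSection _ (WeilDivisor.floor_pullback_nonneg f hΔ) (f ⁻¹ᵁ U) := by
    exact congrArg (fun s ↦ s.1 (.op (f ⁻¹ᵁ U)))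
      ((SheafOfModules.unitHomEquiv (divisorSheaf _)).apply_symm_apply
        (oneSection _ (WeilDivisor.floor_pullback_nonneg f hΔ)))
  refine (congrArg _ h1).trans h2

/-- A map out of the structure sheaf is determined by the image of `1`, so the retraction identity
need only be tested there. -/
theorem isSplitMono_plusMap_iff_exists_sections (f : Y ⟶ X) [IsFinite f] (Δ : WeilDivisor X ℚ)
    (hΔ : 0 ≤ Δ) : IsSplitMono (plusMap f Δ hΔ) ↔
      ∃ r : ∀ U : X.Opens,
        divisorSections (WeilDivisor.floor (WeilDivisor.pullback f Δ)) (f ⁻¹ᵁ U) →+ Γ(X, U),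
        (∀ (U V : X.Opens) (h : U ≤ V) (s),
          r U (resDivisorSection _ (f.preimage_mono h) s) = X.presheaf.map (homOfLE h).op (r V s)) ∧
        (∀ (U : X.Opens) (c : Γ(X, U)) (s), r U (f.app U c • s) = c * r U s) ∧
        ∀ U, r U (oneDivisorSection _ (WeilDivisor.floor_pullback_nonneg f hΔ) _) = 1 := by
  set E := WeilDivisor.floor (WeilDivisor.pullback f Δ) with hE
  constructor
  · intro h
    let ρ := retraction (plusMap f Δ hΔ)
    refine ⟨fun U ↦ (ρ.app U).hom, fun U V h s ↦ ?_, fun U c s ↦ ?_, fun U ↦ ?_⟩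
    · exact PresheafOfModules.naturality_apply ρ.val (homOfLE h).op s
    · exact Scheme.Modules.Hom.app_smul ρ c s
    · have h1 := congrArg (fun ψ : structureModule X ⟶ structureModule X ↦
        ψ.val.app (.op U) (1 : Γ(X, U))) (IsSplitMono.id (plusMap f Δ hΔ))
      refine Eq.trans ?_ h1
      exact (congrArg (fun s ↦ ρ.val.app (.op U) s) (plusMap_one f Δ hΔ U)).symm
  · rintro ⟨r, hres, hsmul, hone⟩
    let ρ : (Scheme.Modules.pushforward f).obj (divisorSheaf E) ⟶ structureModule X :=
      ⟨PresheafOfModules.homMk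
        { app U := AddCommGrpCat.ofHom (r U.unop)
          naturality U V i := by
            ext s
            exact hres _ _ i.unop.le s }
        fun U c s ↦ hsmul _ c s⟩
    refine ⟨⟨⟨ρ, ?_⟩⟩⟩
    refine (SheafOfModules.unitHomEquiv (structureModule X)).injective ?_
    refine PresheafOfModules.sections_ext _ _ fun U ↦ ?_
    refine Eq.trans ?_ (hone U.unop)
    exact congrArg (fun s ↦ ρ.val.app U s) (plusMap_one f Δ hΔ U.unop)

/-- The section of `𝒪_Y(E)` over `U` given by a rational function. -/
def constDivisorSection (E : WeilDivisor Y ℤ) (U : Y.Opens) (φ : Y.functionField)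
    (h : IsDivisorSection E U φ) : divisorSections E U :=
  ⟨fun _ ↦ φ, IsLocallyConstant.const φ, fun x ↦ h x.1 x.2⟩

variable [IsIntegral X]

/-- A `K(X)`-linear map `K(Y) → K(X)` that sends `1` to `1` and `f_* 𝒪_Y(E)` into `𝒪_X`. -/
structure IsDivisorRetraction (f : Y ⟶ X) [IsDominant f] (E : WeilDivisor Y ℤ)
    (ρ : Y.functionField →+ X.functionField) : Prop where
  map_mul c φ : ρ (functionFieldMap f c * φ) = c * ρ φ
  map_one : ρ 1 = 1
  mem_range (U : X.Opens) (φ : Y.functionField) : IsDivisorSection E (f ⁻¹ᵁ U) φ →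
    ∀ x ∈ U, coheight x = 1 → ρ φ ∈ (algebraMap (X.presheaf.stalk x) X.functionField).range

/-- Regular functions are sections of `𝒪_Y(E)` since `E` is effective. The retraction over one
affine `W` thus restricts to `Γ(Y, f ⁻¹ᵁ W)`, and localizing at the nonzero functions on `W` extends
it to `K(Y)`. -/
theorem exists_isDivisorRetraction_of_sections (f : Y ⟶ X) [IsFinite f] [IsDominant f]
    (E : WeilDivisor Y ℤ) (hE : 0 ≤ E)
    (r : ∀ U : X.Opens, divisorSections E (f ⁻¹ᵁ U) →+ Γ(X, U))
    (hres : ∀ (U V : X.Opens) (h : U ≤ V) (s), r U (resDivisorSection _ (f.preimage_mono h) s) =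
      X.presheaf.map (homOfLE h).op (r V s))
    (hsmul : ∀ (U : X.Opens) (c : Γ(X, U)) (s), r U (f.app U c • s) = c * r U s)
    (hone : ∀ U, r U (oneDivisorSection _ hE _) = 1) :
    ∃ ρ, IsDivisorRetraction f E ρ := by
  obtain ⟨_, ⟨W, hW, rfl⟩, hxW, -⟩ := X.isBasis_affineOpens.exists_subset_of_mem_open
    (Set.mem_univ (genericPoint X)) isOpen_univ
  replace hW : IsAffineOpen W := hW
  have : Nonempty W := ⟨⟨_, hxW⟩⟩
  have := nonempty_preimage f W
  have := functionField_isFractionRing_of_isAffineOpen X W hW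
  have := functionField_isFractionRing_of_isAffineOpen Y _ (hW.preimage f)
  algebraize [(f.app W).hom]
  let : Algebra Γ(X, W) Y.functionField :=
    ((algebraMap Γ(Y, f ⁻¹ᵁ W) Y.functionField).comp (f.app W).hom).toAlgebra
  have : IsScalarTower Γ(X, W) Γ(Y, f ⁻¹ᵁ W) Y.functionField := .of_algebraMap_eq' rfl
  have hff (a : Γ(X, W)) : algebraMap Γ(X, W) Y.functionField a =
      functionFieldMap f (algebraMap Γ(X, W) X.functionField a) :=
    (functionFieldMap_germToFunctionField f W a).symm
  have : FaithfulSMul Γ(X, W) Γ(Y, f ⁻¹ᵁ W) := by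
    rw [faithfulSMul_iff_algebraMap_injective]
    intro a b hab
    refine IsFractionRing.injective Γ(X, W) X.functionField
      ((functionFieldMap f).injective ?_)
    rw [← hff, ← hff]
    exact congrArg (algebraMap Γ(Y, f ⁻¹ᵁ W) Y.functionField) hab
  have : Algebra.IsIntegral Γ(X, W) Γ(Y, f ⁻¹ᵁ W) :=
    ⟨IsIntegralHom.isIntegral_app f W hW⟩
  let i := (IsScalarTower.toAlgHom Γ(X, W) Γ(Y, f ⁻¹ᵁ W) Y.functionField).toLinearMap
  -- By integrality, inverting the nonzero elements of `Γ(X, W)` already yields all of `K(Y)`.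
  have hi : IsLocalizedModule (nonZeroDivisors Γ(X, W)) i := inferInstance
  let r₀ : Γ(Y, f ⁻¹ᵁ W) →ₗ[Γ(X, W)] X.functionField :=
    { toFun b := algebraMap Γ(X, W) X.functionField (r W (constDivisorSection E _ _
        (isDivisorSection_germToFunctionField E hE _ b)))
      map_add' a b := by
        rw [← map_add, ← map_add]
        congr 2
        exact Subtype.ext (funext fun y ↦ _root_.map_add (Y.germToFunctionField (f ⁻¹ᵁ W)).hom a b)
      map_smul' a b := by
        rw [RingHom.id_apply, Algebra.smul_def a (algebraMap _ _ _), ← _root_.map_mul, ← hsmul]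
        congr 2
        refine Subtype.ext (funext fun y ↦ ?_)
        change _ = toConst _ _ y * _
        rw [toConst_apply]
        exact _root_.map_mul (Y.germToFunctionField (f ⁻¹ᵁ W)).hom _ b }
  let ρ := IsLocalizedModule.lift (nonZeroDivisors Γ(X, W)) i r₀
    (IsLocalizedModule.map_units (Algebra.linearMap Γ(X, W) X.functionField))
  have hρ (b : Γ(Y, f ⁻¹ᵁ W)) : ρ (algebraMap Γ(Y, f ⁻¹ᵁ W) Y.functionField b) = r₀ b :=
    IsLocalizedModule.lift_apply _ i r₀ _ b
  have hmul (a : Γ(X, W)) (φ : Y.functionField) :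
      ρ (functionFieldMap f (algebraMap Γ(X, W) X.functionField a) * φ) =
        algebraMap Γ(X, W) X.functionField a * ρ φ := by
    rw [← hff, ← Algebra.smul_def, map_smul, Algebra.smul_def]
  refine ⟨ρ.toAddMonoidHom, ⟨fun c φ ↦ ?_, ?_, fun U φ hφ x hx hx1 ↦ ?_⟩⟩
  · obtain ⟨a, b, hb, rfl⟩ := IsFractionRing.div_surjective (A := Γ(X, W)) c
    have hb0 : algebraMap Γ(X, W) X.functionField b ≠ 0 := by
      simpa using nonZeroDivisors.ne_zero hb
    refine mul_left_cancel₀ hb0 ?_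
    change _ * ρ _ = _ * (_ * ρ _)
    rw [← hmul, ← mul_assoc, ← _root_.map_mul, mul_div_cancel₀ _ hb0, ← mul_assoc,
      mul_div_cancel₀ _ hb0, hmul]
  · change ρ 1 = 1
    rw [← _root_.map_one (algebraMap Γ(Y, f ⁻¹ᵁ W) Y.functionField), hρ]
    refine (congrArg (algebraMap Γ(X, W) X.functionField) ?_).trans (_root_.map_one _)
    rw [← hone W]
    congr 1
    exact Subtype.ext (funext fun y ↦ _root_.map_one (Y.germToFunctionField (f ⁻¹ᵁ W)).hom)
  · have : Nonempty U := ⟨⟨x, hx⟩⟩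
    have hη : genericPoint X ∈ U :=
      ((genericPoint_spec X).mem_open_set_iff U.isOpen).2 ⟨x, trivial, hx⟩
    -- `ρ` comes from `r W`, whereas `φ` is a section over `U`. The two are compared on an overlap
    -- `V` after multiplying `φ` by a denominator `s`, which makes it the regular function `b`.
    obtain ⟨V, hVU, hVW, hV⟩ : ∃ V : X.Opens, V ≤ U ∧ V ≤ W ∧ Nonempty V :=
      ⟨U ⊓ W, inf_le_left, inf_le_right, ⟨⟨_, hη, hxW⟩⟩⟩
    have := nonempty_preimage f V
    obtain ⟨⟨b, s⟩, hbs⟩ := IsLocalizedModule.surj (nonZeroDivisors Γ(X, W)) i φ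
    have hs0 : algebraMap Γ(X, W) X.functionField s ≠ 0 := by simp
    replace hbs : functionFieldMap f (algebraMap Γ(X, W) X.functionField s) * φ =
        algebraMap Γ(Y, f ⁻¹ᵁ W) Y.functionField b := by
      rw [← hff, ← Algebra.smul_def]
      exact hbs
    have hg (V V' : X.Opens) (h : V ≤ V') [Nonempty V] [Nonempty V'] (a : Γ(X, V')) :
        X.germToFunctionField V (X.presheaf.map (homOfLE h).op a) = X.germToFunctionField V' a :=
      X.presheaf.germ_res_apply _ _ _ _
    let c := r U (constDivisorSection E _ φ hφ)
    suffices h : ρ φ = X.germToFunctionField U c by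
      refine ⟨X.presheaf.germ U x hx c, ?_⟩
      rw [Scheme.algebraMap_germ_eq_germToFunctionField]
      exact h.symm
    refine mul_left_cancel₀ hs0 ?_
    rw [← hmul, hbs, hρ]
    change X.germToFunctionField W _ = X.germToFunctionField W _ * _
    rw [← hg V W hVW, ← hg V W hVW, ← hg V U hVU,
      ← _root_.map_mul, ← hres, ← hres, ← hsmul]
    congr 2
    refine Subtype.ext (funext fun y ↦ ?_)
    change Y.germToFunctionField _ b = toConst _ _ y * φ
    rw [toConst_apply]
    refine Eq.trans hbs.symm (congrArg (· * φ) ?_)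
    change _ = Y.germToFunctionField _ _
    rw [← functionFieldMap_germToFunctionField f V, hg]
    rfl

/-- Apply `ρ` to the rational function underlying a section; Hartogs makes the result regular on all
of `U`. Compatibilities are then checked in `K(X)`. -/
theorem exists_sections_of_isDivisorRetraction [IsLocallyNoetherian X] [IsNormalScheme X]
    (f : Y ⟶ X) [IsDominant f]
    (E : WeilDivisor Y ℤ) (hE : 0 ≤ E) (ρ) (hρ : IsDivisorRetraction f E ρ) :
    ∃ r : ∀ U : X.Opens, divisorSections E (f ⁻¹ᵁ U) →+ Γ(X, U),
      (∀ (U V : X.Opens) (h : U ≤ V) (s), r U (resDivisorSection _ (f.preimage_mono h) s) =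
        X.presheaf.map (homOfLE h).op (r V s)) ∧
      (∀ (U : X.Opens) (c : Γ(X, U)) (s), r U (f.app U c • s) = c * r U s) ∧
      ∀ U, r U (oneDivisorSection _ hE _) = 1 := by
  have hη (U : X.Opens) [hU : Nonempty U] : genericPoint Y ∈ f ⁻¹ᵁ U := by
    change f _ ∈ U
    rw [map_genericPoint]
    exact ((genericPoint_spec X).mem_open_set_iff U.isOpen).2 (by simpa using hU)
  have key (U : X.Opens) (s : divisorSections E (f ⁻¹ᵁ U)) : ∃ c : Γ(X, U), ∀ [Nonempty U],
      X.germToFunctionField U c = ρ (s.1 ⟨_, hη U⟩) := by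
    rcases isEmpty_or_nonempty U with hU | hU
    · exact ⟨0, fun {h} ↦ hU.elim h.some⟩
    · have := nonempty_preimage f U
      -- Sections are only locally constant functions, but `f ⁻¹ᵁ U` is irreducible, so the value at
      -- the generic point is the value everywhere.
      have hpre : PreirreducibleSpace (f ⁻¹ᵁ U) := inferInstance
      obtain ⟨c, hc⟩ := exists_germToFunctionField_eq_of_forall_coheight_eq_one U
        (ρ (s.1 ⟨_, hη U⟩)) fun x hx hx1 ↦ hρ.mem_range U _ (fun y hy hy1 ↦ by
          have := s.2.1.apply_eq_of_isPreconnected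
              (PreirreducibleSpace.isPreirreducible_univ (X := f ⁻¹ᵁ U)).isPreconnected
            (Set.mem_univ ⟨_, hη U⟩) (Set.mem_univ ⟨y, hy⟩)
          rw [this]
          exact s.2.2 ⟨y, hy⟩ hy1) x hx hx1
      exact ⟨c, hc⟩
  choose r hr using key
  have hext (U : X.Opens) (a b : Γ(X, U)) (hab : ∀ [Nonempty U],
      X.germToFunctionField U a = X.germToFunctionField U b) : a = b := by
    rcases isEmpty_or_nonempty U with hU | hU
    · have : Subsingleton Γ(X, U) := by
        rw [show U = ⊥ from SetLike.coe_injective (Set.isEmpty_coe_sort.1 hU)]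
        infer_instance
      exact Subsingleton.elim _ _
    · exact X.germToFunctionField_injective U hab
  refine ⟨fun U ↦ AddMonoidHom.mk' (r U) fun s t ↦ hext U _ _ ?_, fun U V h s ↦ hext U _ _ ?_,
    fun U c s ↦ hext U _ _ ?_, fun U ↦ hext U _ _ ?_⟩
  · intro _
    rw [_root_.map_add, hr, hr, hr, ← _root_.map_add]
    rfl
  · intro hU
    have : Nonempty V := hU.map (Set.inclusion h)
    refine (hr U _).trans (((hr V s).symm.trans ?_))
    exact (X.presheaf.germ_res_apply _ _ _ _).symm
  · intro _
    have := nonempty_preimage f U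
    rw [_root_.map_mul]
    refine (hr U _).trans ?_
    refine Eq.trans ?_ (congrArg _ (hr U s).symm)
    rw [← hρ.map_mul, functionFieldMap_germToFunctionField]
    congr 1
    change toConst (f ⁻¹ᵁ U) (f.app U c) ⟨_, hη U⟩ * s.1 ⟨_, hη U⟩ = _
    rw [toConst_apply]
    rfl
  · intro _
    rw [_root_.map_one]
    exact (hr U _).trans hρ.map_one

theorem isSplitMono_plusMap_iff_exists_isDivisorRetraction [IsLocallyNoetherian X]
    [IsNormalScheme X] (f : Y ⟶ X) [IsFinite f] [IsDominant f] (Δ : WeilDivisor X ℚ)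
    (hΔ : 0 ≤ Δ) : IsSplitMono (plusMap f Δ hΔ) ↔
      ∃ ρ, IsDivisorRetraction f (WeilDivisor.floor (WeilDivisor.pullback f Δ)) ρ := by
  rw [isSplitMono_plusMap_iff_exists_sections]
  constructor
  · rintro ⟨r, hres, hsmul, hone⟩
    exact exists_isDivisorRetraction_of_sections f _ _ r hres hsmul hone
  · rintro ⟨ρ, hρ⟩
    exact exists_sections_of_isDivisorRetraction f _ _ ρ hρ

end Retraction

/-! ### Transfer of splittings through a common open subscheme. -/

section Transfer

variable {X Y Z S T Q : Scheme.{u}} [IsIntegral X] [IsIntegral Y] [IsIntegral Z] [IsIntegral S]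
  [IsIntegral T] [IsIntegral Q] [IsLocallyNoetherian S] [IsLocallyNoetherian T]
  [IsLocallyNoetherian Q]
  {a : Z ⟶ X} {b : Z ⟶ Y} {h : S ⟶ X} {g : T ⟶ Y} {q : Q ⟶ Z} {j : Q ⟶ S} {i : Q ⟶ T}
  [IsOpenImmersion a] [IsOpenImmersion b] [IsOpenImmersion j] [IsOpenImmersion i]

/-- Conjugate `ρ` by the isomorphisms of function fields. The hypothesis `hrange` ensures that a
section of `F` over `g ⁻¹ᵁ W` satisfies the condition for `E` at every point of `S` over the
corresponding open of `X`: no such point lies outside `Q`. -/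
theorem exists_isDivisorRetraction_of_isOpenImmersion
    [IsDominant h] [IsDominant g] [IsDominant q]
    (hj : j ≫ h = q ≫ a) (hi : i ≫ g = q ≫ b)
    (hrange : ∀ s, h s ∈ Set.range a → s ∈ Set.range j)
    (hb : ∀ y : Y, coheight y = 1 → y ∈ Set.range b)
    {E : WeilDivisor S ℤ} {F : WeilDivisor T ℤ} (hEF : ∀ w, E.1 (j w) = F.1 (i w))
    {ρ : S.functionField →+ X.functionField} (hρ : IsDivisorRetraction h E ρ) :
    ∃ ρ', IsDivisorRetraction g F ρ' := by
  have := isDominant_of_isOpenImmersion a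
  have := isDominant_of_isOpenImmersion b
  have := isDominant_of_isOpenImmersion i
  have := isDominant_of_isOpenImmersion j
  let eb := RingEquiv.ofBijective (functionFieldMap b) (functionFieldMap_bijective b)
  let ej := RingEquiv.ofBijective (functionFieldMap j) (functionFieldMap_bijective j)
  have heb (x) : functionFieldMap b (eb.symm x) = x := eb.apply_symm_apply x
  have hej (x) : functionFieldMap j (ej.symm x) = x := ej.apply_symm_apply x
  have hcj (x) : functionFieldMap j (functionFieldMap h x) =
      functionFieldMap q (functionFieldMap a x) := by
    rw [← functionFieldMap_comp, ← functionFieldMap_comp, functionFieldMap_congr hj]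
  have hci (x) : functionFieldMap i (functionFieldMap g x) =
      functionFieldMap q (functionFieldMap b x) := by
    rw [← functionFieldMap_comp, ← functionFieldMap_comp, functionFieldMap_congr hi]
  refine ⟨eb.symm.toAddEquiv.toAddMonoidHom.comp ((functionFieldMap a).toAddMonoidHom.comp
    (ρ.comp (ej.symm.toAddEquiv.toAddMonoidHom.comp (functionFieldMap i).toAddMonoidHom))), ⟨fun c φ ↦ ?_, ?_,
      fun W φ hφ y hy hy1 ↦ ?_⟩⟩
  · obtain ⟨d, hd⟩ := (functionFieldMap_bijective a).2 (functionFieldMap b c)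
    have h1 : ej.symm (functionFieldMap i (functionFieldMap g c * φ)) =
        functionFieldMap h d * ej.symm (functionFieldMap i φ) := by
      apply (functionFieldMap j).injective
      rw [hej, map_mul, map_mul, hej, hci, ← hd, hcj]
    change eb.symm (functionFieldMap a (ρ (ej.symm (functionFieldMap i
      (functionFieldMap g c * φ))))) = c * eb.symm (functionFieldMap a (ρ (ej.symm
        (functionFieldMap i φ))))
    apply (functionFieldMap b).injective
    rw [h1, hρ.map_mul, map_mul, map_mul, map_mul, map_mul, heb, heb, hd]
  · change eb.symm (functionFieldMap a (ρ (ej.symm (functionFieldMap i 1)))) = 1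
    rw [map_one, map_one, hρ.map_one, map_one, map_one]
  · change eb.symm (functionFieldMap a (ρ (ej.symm (functionFieldMap i φ)))) ∈ _
    obtain ⟨z, rfl⟩ := hb y hy1
    rw [← functionFieldMap_mem_range_iff, heb, functionFieldMap_mem_range_iff]
    -- The open set of `X` is the trace of `W` on `Z`; it contains the point `a z` that corresponds
    -- to `y = b z`.
    refine hρ.mem_range (a ''ᵁ (b ⁻¹ᵁ W)) _ ?_ _ ⟨z, hy, rfl⟩ ?_
    · rintro s ⟨z', hz', hs⟩ hs1
      obtain ⟨w, rfl⟩ := hrange s ⟨z', hs⟩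
      have hw : i w ∈ g ⁻¹ᵁ W := by
        have h1 : a (q w) = a z' := by
          refine Eq.trans ?_ hs.symm
          rw [← Scheme.Hom.comp_apply, ← Scheme.Hom.comp_apply, hj]
        change g (i w) ∈ W
        rw [← Scheme.Hom.comp_apply, hi, Scheme.Hom.comp_apply, a.isOpenEmbedding.injective h1]
        exact hz'
      rw [coheight_eq_of_isOpenImmersion] at hs1
      rw [← ord_functionFieldMap, hej, ord_functionFieldMap, hEF]
      refine (hφ (i w) hw ?_).imp_left fun h0 ↦ ?_
      · rwa [coheight_eq_of_isOpenImmersion]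
      · rw [h0, map_zero, map_zero]
    · rw [coheight_eq_of_isOpenImmersion] at hy1 ⊢
      exact hy1

theorem isSplitMono_plusMap_of_isOpenImmersion [IsLocallyNoetherian X] [IsNormalScheme X]
    [IsLocallyNoetherian Y] [IsNormalScheme Y] [IsNormalScheme S] [IsNormalScheme T]
    [IsFinite h] [IsFinite g] [IsDominant h] [IsDominant g] [IsDominant q]
    (hj : j ≫ h = q ≫ a) (hi : i ≫ g = q ≫ b)
    (hrange : ∀ s, h s ∈ Set.range a → s ∈ Set.range j)
    (hb : ∀ y : Y, coheight y = 1 → y ∈ Set.range b)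
    {Δ : WeilDivisor X ℚ} (hΔ : 0 ≤ Δ) {Θ : WeilDivisor Y ℚ} (hΘ : 0 ≤ Θ)
    (hΔΘ : ∀ z, Δ.1 (a z) = Θ.1 (b z)) (hsplit : IsSplitMono (plusMap h Δ hΔ)) :
    IsSplitMono (plusMap g Θ hΘ) := by
  rw [isSplitMono_plusMap_iff_exists_isDivisorRetraction] at hsplit ⊢
  obtain ⟨ρ, hρ⟩ := hsplit
  refine exists_isDivisorRetraction_of_isOpenImmersion hj hi hrange hb (fun w ↦ ?_) hρ
  -- Both indices equal that of `q` at `w`.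
  have h1 : WeilDivisor.ramificationIndex h (j w) = WeilDivisor.ramificationIndex g (i w) := by
    rw [← ramificationIndex_comp_of_isOpenImmersion_left, hj,
      ramificationIndex_comp_of_isOpenImmersion_right,
      ← ramificationIndex_comp_of_isOpenImmersion_right q b, ← hi,
      ramificationIndex_comp_of_isOpenImmersion_left]
  have h2 : Δ.1 (h (j w)) = Θ.1 (g (i w)) := by
    rw [← Scheme.Hom.comp_apply, ← Scheme.Hom.comp_apply, hj, hi, Scheme.Hom.comp_apply,
      Scheme.Hom.comp_apply, hΔΘ]
  have h3 : coheight (j w) = coheight (i w) :=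
    (coheight_eq_of_isOpenImmersion j).trans (coheight_eq_of_isOpenImmersion i).symm
  change ⌊if coheight (j w) = 1 then (WeilDivisor.ramificationIndex h (j w) : ℚ) * Δ.1 (h (j w))
    else 0⌋ = ⌊if coheight (i w) = 1 then
      (WeilDivisor.ramificationIndex g (i w) : ℚ) * Θ.1 (g (i w)) else 0⌋
  rw [h1, h2, h3]

end Transfer

/-! ### Normality and finiteness of normalizations. -/

section Normalization

theorem exists_isAffineOpen_mem {X : Scheme.{u}} (x : X) :
    ∃ U : X.Opens, IsAffineOpen U ∧ x ∈ U := by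
  obtain ⟨_, ⟨W, hW, rfl⟩, hxW, -⟩ := X.isBasis_affineOpens.exists_subset_of_mem_open
    (Set.mem_univ x) isOpen_univ
  exact ⟨W, hW, hxW⟩

theorem isNormalScheme_of_isOpenImmersion {X Y : Scheme.{u}} [IsNormalScheme X]
    [IsIntegral Y] (f : Y ⟶ X)
    [IsOpenImmersion f] : IsNormalScheme Y where
  isDomain_stalk _ := inferInstance
  isIntegrallyClosed_stalk y := by
    have := IsNormalScheme.isIntegrallyClosed_stalk (f y)
    exact .of_equiv (asIso (f.stalkMap y)).commRingCatIsoToRingEquiv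

theorem isNormalScheme_of_isIntegrallyClosed {X : Scheme.{u}} [IsIntegral X]
    (h : ∀ x : X, ∃ U : X.Opens, x ∈ U ∧ IsAffineOpen U ∧ IsIntegrallyClosed Γ(X, U)) :
    IsNormalScheme X where
  isDomain_stalk _ := inferInstance
  isIntegrallyClosed_stalk x := by
    obtain ⟨U, hxU, hU, hcl⟩ := h x
    have : Nonempty U := ⟨⟨x, hxU⟩⟩
    let := X.presheaf.algebra_section_stalk (U := U) ⟨x, hxU⟩
    have := hU.isLocalization_stalk ⟨x, hxU⟩
    exact isIntegrallyClosed_of_isLocalization (X.presheaf.stalk x) _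
      (Ideal.primeCompl_le_nonZeroDivisors (hU.primeIdealOf ⟨x, hxU⟩).asIdeal)

/-- Over an affine `W` its ring of functions is the integral closure of `Γ(X, W)` in the integrally
closed domain `Γ(Q, f ⁻¹ᵁ W)`, hence itself integrally closed. -/
instance isNormalScheme_normalization {X Q : Scheme.{u}} [IsIntegral Q] [IsNormalScheme Q]
    (f : Q ⟶ X) [QuasiCompact f] [QuasiSeparated f] : IsNormalScheme f.normalization := by
  refine isNormalScheme_of_isIntegrallyClosed fun s ↦ ?_
  obtain ⟨W, hW, hsW⟩ := exists_isAffineOpen_mem (f.fromNormalization s)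
  refine ⟨f.fromNormalization ⁻¹ᵁ W, hsW, hW.preimage _, ?_⟩
  have : Nonempty (f ⁻¹ᵁ W) := by
    obtain ⟨w, hw⟩ := f.toNormalization.denseRange.exists_mem_open
      (f.fromNormalization ⁻¹ᵁ W).isOpen ⟨s, hsW⟩
    refine ⟨⟨w, ?_⟩⟩
    rw [← f.toNormalization_fromNormalization]
    exact hw
  have := isIntegrallyClosed_sections (f ⁻¹ᵁ W)
  let := (f.app W).hom.toAlgebra
  have : IsIntegrallyClosed (integralClosure Γ(X, W) Γ(Q, f ⁻¹ᵁ W)) :=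
    .of_isIntegrallyClosed_of_isIntegrallyClosedIn _ Γ(Q, f ⁻¹ᵁ W)
  exact .of_equiv (f.normalizationObjIso hW).symm.commRingCatIsoToRingEquiv

/-- Over an affine open of `X`, the extension of fraction fields is the base change of the finite
extension of rings of functions. -/
theorem finite_functionFieldMap {X Y : Scheme.{u}} [IsIntegral X] [IsIntegral Y] (f : Y ⟶ X)
    [IsFinite f] [IsDominant f] : (functionFieldMap f).Finite := by
  obtain ⟨W, hW, hxW⟩ := exists_isAffineOpen_mem (genericPoint X)
  have : Nonempty W := ⟨⟨_, hxW⟩⟩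
  have := nonempty_preimage f W
  have := functionField_isFractionRing_of_isAffineOpen X W hW
  have := functionField_isFractionRing_of_isAffineOpen Y _ (hW.preimage f)
  algebraize [(f.app W).hom, functionFieldMap f]
  let : Algebra Γ(X, W) Y.functionField :=
    ((algebraMap Γ(Y, f ⁻¹ᵁ W) Y.functionField).comp (f.app W).hom).toAlgebra
  have : IsScalarTower Γ(X, W) Γ(Y, f ⁻¹ᵁ W) Y.functionField := .of_algebraMap_eq' rfl
  have hff (a : Γ(X, W)) : algebraMap Γ(X, W) Y.functionField a =
      functionFieldMap f (algebraMap Γ(X, W) X.functionField a) :=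
    (functionFieldMap_germToFunctionField f W a).symm
  have : IsScalarTower Γ(X, W) X.functionField Y.functionField := .of_algebraMap_eq hff
  have : FaithfulSMul Γ(X, W) Γ(Y, f ⁻¹ᵁ W) := by
    rw [faithfulSMul_iff_algebraMap_injective]
    intro a b hab
    refine IsFractionRing.injective Γ(X, W) X.functionField
      ((functionFieldMap f).injective ?_)
    rw [← hff, ← hff]
    exact congrArg (algebraMap Γ(Y, f ⁻¹ᵁ W) Y.functionField) hab
  have : Module.Finite Γ(X, W) Γ(Y, f ⁻¹ᵁ W) := f.finite_app W hW
  have := Algebra.IsAlgebraic.isBaseChange_of_isFractionRing Γ(X, W) Γ(Y, f ⁻¹ᵁ W)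
    X.functionField Y.functionField
  change Module.Finite X.functionField Y.functionField
  exact Module.Finite.equiv this.equiv

/-- The N-2 property at the prime `⊥` makes the integral closure in `L` finite; the closure in `C`
is a submodule of it, and `A` is Noetherian. -/
theorem IsNagataRing.finite_integralClosure {A : Type u} [CommRing A] [IsDomain A]
    (hA : IsNagataRing A) {K L C : Type u} [Field K] [Algebra A K] [IsFractionRing A K] [Field L]
    (i : K →+* L) (hi : i.Finite) [CommRing C] [Algebra A C] (k : C →+* L)
    (hk : Function.Injective k)
    (hik : ∀ x, k (algebraMap A C x) = i (algebraMap A K x)) :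
    Module.Finite A (integralClosure A C) := by
  have := hA.1
  let R := A ⧸ (⊥ : Ideal A)
  let e : R ≃+* A := RingEquiv.quotientBot A
  let : Algebra R K := ((algebraMap A K).comp (e : R →+* A)).toAlgebra
  have : IsFractionRing R K :=
    (IsFractionRing.isFractionRing_iff_of_base_ringEquiv K e.symm).1 inferInstance
  let eF : FractionRing R ≃ₐ[R] K := FractionRing.algEquiv R K
  let : Algebra R L := (i.comp (algebraMap R K)).toAlgebra
  let : Algebra (FractionRing R) L := (i.comp (eF : FractionRing R →+* K)).toAlgebra
  have : IsScalarTower R (FractionRing R) L := .of_algebraMap_eq fun x ↦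
    (congrArg i (eF.commutes x)).symm
  have hfin : Module.Finite (FractionRing R) L :=
    hi.comp (RingHom.Finite.of_surjective (eF : FractionRing R →+* K) eF.surjective)
  have : Module.Finite R (integralClosure R L) := hA.2 ⊥ L hfin
  let : Algebra A L := (k.comp (algebraMap A C)).toAlgebra
  have : IsScalarTower A R L := .of_algebraMap_eq fun x ↦ hik x
  have : Module.Finite A (integralClosure R L) := .trans R _
  let ka : C →ₐ[A] L := { k with commutes' := fun _ ↦ rfl }
  let φ : integralClosure A C →ₗ[A] integralClosure R L :=
    { toFun x := ⟨k x, (x.2.map ka).tower_top⟩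
      map_add' x y := Subtype.ext (map_add k _ _)
      map_smul' a x := Subtype.ext (map_smul ka a x.1) }
  exact Module.Finite.of_injective φ fun x y hxy ↦
    Subtype.ext (hk (congrArg Subtype.val hxy))

/-- A Nagata scheme provides one good affine neighbourhood of each point, so finiteness has to be
tested on such a cover. -/
theorem isFinite_of_forall_exists {X Y : Scheme.{u}} (f : Y ⟶ X) [IsAffineHom f]
    (h : ∀ x : X, ∃ U : X.Opens, x ∈ U ∧ IsAffineOpen U ∧ (f.app U).hom.Finite) : IsFinite f := by
  choose U hxU hU hfin using h
  have hP :=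
    IsFinite.instHasAffinePropertyAndIsAffineFiniteCarrierObjOppositeOpensCarrierCarrierCommRingCatPresheafOpOpensTopHomAppTop.{u}
  refine (@HasAffineProperty.iff_of_iSup_eq_top _ _ hP _ _ f _ (fun x ↦ ⟨U x, hU x⟩)
    (top_le_iff.1 fun x _ ↦ Opens.mem_iSup.2 ⟨x, hxU x⟩)).2 fun x ↦ ?_
  have h (V : X.Opens) (hV : V = U x) : (f.app V).hom.Finite := by
    subst hV
    exact hfin x
  have h' : (f ∣_ U x).appTop.hom.Finite := by
    rw [morphismRestrict_appTop]
    exact (RingHom.finite_respectsIso.cancel_right_isIso _ _).2 (h _ (U x).ι_image_top)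
  exact ⟨(hU x).preimage f, h'⟩

end Normalization

/-! ### Normalization in a finite cover of an open subscheme. -/

section NormalizationInOpen

/-- The map from `Q` to the preimage of `Z` in `S` is an open immersion and also finite. Its image
is open and closed in an irreducible scheme, hence everything. -/
theorem mem_range_of_isFinite_comp {X Z S Q : Scheme.{u}} [IsIntegral S] [IsIntegral Q]
    {a : Z ⟶ X} {h : S ⟶ X}
    {q : Q ⟶ Z} {j : Q ⟶ S} [IsOpenImmersion a] [IsOpenImmersion j] [IsFinite q]
    [IsSeparated h] (hj : j ≫ h = q ≫ a) (s : S) (hs : h s ∈ Set.range a) :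
    s ∈ Set.range j := by
  let l : Q ⟶ Limits.pullback h a := Limits.pullback.lift j q hj
  have hl1 : l ≫ Limits.pullback.fst h a = j := Limits.pullback.lift_fst ..
  have hl2 : l ≫ Limits.pullback.snd h a = q := Limits.pullback.lift_snd ..
  have : IsOpenImmersion (l ≫ Limits.pullback.fst h a) := hl1 ▸ inferInstance
  have : IsOpenImmersion l := IsOpenImmersion.of_comp l (Limits.pullback.fst h a)
  have : Nonempty (Limits.pullback h a : Scheme.{u}) := ⟨l (Classical.arbitrary Q)⟩
  have : IsIntegral (Limits.pullback h a) :=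
    isIntegral_of_isOpenImmersion (Limits.pullback.fst h a)
  have := isDominant_of_isOpenImmersion l
  have : IsFinite l := by
    apply MorphismProperty.of_postcomp (W := @IsFinite) (W' := @IsSeparated) l
      (Limits.pullback.snd h a)
    · infer_instance
    · rw [hl2]; infer_instance
  have hsurj : Function.Surjective l := by
    rw [← Set.range_eq_univ, ← l.isClosedMap.isClosed_range.closure_eq]
    exact l.denseRange.closure_range
  obtain ⟨z, hz⟩ := hs
  obtain ⟨p, hp, -⟩ := Scheme.Pullback.exists_preimage_pullback s z hz.symm
  obtain ⟨t, rfl⟩ := hsurj p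
  exact ⟨t, by rw [← hp, ← hl1, Scheme.Hom.comp_apply]⟩

/-- `K(Q)` is finite over `K(Z) = K(X)`, and the functions on a preimage in `Q` embed into it, so
the Nagata condition bounds their integral closure. -/
theorem isFinite_fromNormalization {X Z Q : Scheme.{u}} [IsIntegral X] [IsLocallyNoetherian X]
    [IsNagataScheme X] [IsIntegral Z] [IsIntegral Q] (a : Z ⟶ X) [IsOpenImmersion a] (q : Q ⟶ Z)
    [IsFinite q] [IsDominant q] : IsFinite (q ≫ a).fromNormalization := by
  have := isDominant_of_isOpenImmersion a
  refine isFinite_of_forall_exists _ fun x ↦ ?_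
  obtain ⟨W, hxW, hW, hN⟩ := IsNagataScheme.exists_isNagataRing x
  refine ⟨W, hxW, hW, ?_⟩
  set f := q ≫ a
  have : Nonempty W := ⟨x, hxW⟩
  have : Nonempty (f ⁻¹ᵁ W) := nonempty_preimage f W
  let := (f.app W).hom.toAlgebra
  have hfin : (functionFieldMap f).Finite := by
    have h1 := (finite_functionFieldMap q).comp
      (RingHom.Finite.of_surjective (functionFieldMap a) (functionFieldMap_bijective a).2)
    have h2 : functionFieldMap f = (functionFieldMap q).comp (functionFieldMap a) := by
      ext x
      exact functionFieldMap_comp a q x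
    rw [h2]
    exact h1
  have := functionField_isFractionRing_of_isAffineOpen X W hW
  have := hN.finite_integralClosure (K := X.functionField) (C := Γ(Q, f ⁻¹ᵁ W))
    (functionFieldMap f) hfin (Q.germToFunctionField (f ⁻¹ᵁ W)).hom
    (Scheme.germToFunctionField_injective _ _) fun x ↦
      (functionFieldMap_germToFunctionField f W x).symm
  rw [f.fromNormalization_app hW]
  refine (RingHom.finite_respectsIso.cancel_right_isIso _ _).2 ?_
  exact RingHom.finite_algebraMap.2 this

end NormalizationInOpen

/-- Splitting along a finite dominant morphism to `Y` follows from splitting along all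
finite dominant morphisms to `X`, when both schemes share an open subscheme `Z` that contains the
points of codimension one of `Y`. -/
theorem isSplitMono_plusMap_of_isNagataScheme {X Y Z T : Scheme.{u}}
    [IsIntegral X] [IsLocallyNoetherian X] [IsNormalScheme X] [IsNagataScheme X]
    [IsIntegral Y] [IsLocallyNoetherian Y] [IsNormalScheme Y] [IsIntegral Z]
    [IsIntegral T] [IsLocallyNoetherian T] [IsNormalScheme T]
    (a : Z ⟶ X) (b : Z ⟶ Y) [IsOpenImmersion a] [IsOpenImmersion b]
    (hb : ∀ y : Y, coheight y = 1 → y ∈ Set.range b)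
    (g : T ⟶ Y) [IsFinite g] [IsDominant g] {Δ : WeilDivisor X ℚ} (hΔ : 0 ≤ Δ)
    {Θ : WeilDivisor Y ℚ} (hΘ : 0 ≤ Θ) (hΔΘ : ∀ z, Δ.1 (a z) = Θ.1 (b z))
    (hX : ∀ (S : Scheme.{u}) [IsIntegral S] [IsLocallyNoetherian S] [IsNormalScheme S]
      (h : S ⟶ X) [IsFinite h] [IsDominant h], IsSplitMono (plusMap h Δ hΔ)) :
    IsSplitMono (plusMap g Θ hΘ) := by
  let Q := Limits.pullback g b
  let i : Q ⟶ T := Limits.pullback.fst g b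
  let q : Q ⟶ Z := Limits.pullback.snd g b
  have : Surjective g := surjective_of_isDominant_of_isClosed_range g g.isClosedMap.isClosed_range
  have : Surjective q := inferInstanceAs (Surjective (Limits.pullback.snd g b))
  have : IsFinite q := inferInstanceAs (IsFinite (Limits.pullback.snd g b))
  have : IsOpenImmersion i := inferInstanceAs (IsOpenImmersion (Limits.pullback.fst g b))
  have : Nonempty Q := ⟨(q.surjective (Classical.arbitrary Z)).choose⟩
  have : IsIntegral Q := isIntegral_of_isOpenImmersion i
  have : IsNormalScheme Q := isNormalScheme_of_isOpenImmersion i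
  have : IsLocallyNoetherian Q := isLocallyNoetherian_of_isOpenImmersion i
  have := isDominant_of_isOpenImmersion a
  have := isFinite_fromNormalization a q
  let h := (q ≫ a).fromNormalization
  let j := (q ≫ a).toNormalization
  have hj : j ≫ h = q ≫ a := Scheme.Hom.toNormalization_fromNormalization _
  have : IsDominant (q ≫ a) := inferInstance
  have : IsDominant (j ≫ h) := by rwa [hj]
  have : IsDominant h := .of_comp j h
  have := LocallyOfFiniteType.isLocallyNoetherian h
  -- Zariski's main theorem: `q ≫ a` is quasi-finite and separated, so `Q` is open in the
  -- normalization.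
  have : IsOpenImmersion j := inferInstanceAs (IsOpenImmersion (q ≫ a).toNormalization)
  exact isSplitMono_plusMap_of_isOpenImmersion hj Limits.pullback.condition
    (fun s hs ↦ mem_range_of_isFinite_comp hj s hs) hb hΔ hΘ hΔΘ (hX _ h)

/-! ### Strict transforms and the conclusion. -/

namespace WeilDivisor

variable {X Y : Scheme.{u}} [IsLocallyNoetherian Y] (f : X.PartialIso Y) (D : WeilDivisor X ℚ)

theorem pushforward_apply_of_mem {y : Y} (hy : y ∈ f.target) :
    (pushforward f D).1 y = D.1 ((f.iso.inv ≫ f.source.ι) ⟨y, hy⟩) :=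
  dif_pos hy

theorem pushforward_apply_of_notMem {y : Y} (hy : y ∉ f.target) : (pushforward f D).1 y = 0 :=
  dif_neg hy

theorem pushforward_apply (x : f.source.toScheme) :
    (pushforward f D).1 ((f.iso.hom ≫ f.target.ι) x) = D.1 (f.source.ι x) := by
  refine (pushforward_apply_of_mem f D (f.iso.hom x).2).trans ?_
  congr 1
  change (f.iso.inv ≫ f.source.ι) (f.iso.hom x) = _
  rw [← Scheme.Hom.comp_apply, Iso.hom_inv_id_assoc]

end WeilDivisor

end PlusRegular

end

theorem mainTheorem11 (X Y : Scheme.{u})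
    [IsIntegral X] [IsLocallyNoetherian X] [PlusRegular.IsNormalScheme X]
    [PlusRegular.IsNagataScheme X]
    [IsIntegral Y] [IsLocallyNoetherian Y] [PlusRegular.IsNormalScheme Y]
    (Δ : PlusRegular.WeilDivisor X ℚ)
    (hX : PlusRegular.IsStronglyGloballyPlusRegular X Δ)
    (f : X.PartialIso Y) (hf : PlusRegular.IsSmall f) :
    PlusRegular.IsStronglyGloballyPlusRegular Y (PlusRegular.WeilDivisor.pushforward f Δ) := by
  open PlusRegular in
  intro D hD
  -- The strict transform of `D`. Pushforward is defined for `ℚ`-divisors, so `D` is made rational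
  -- with factor `1` and rounded down afterwards, which changes nothing.
  let D' : WeilDivisor X ℤ :=
    WeilDivisor.floor (WeilDivisor.pushforward f.symm (WeilDivisor.ratSMul 1 D))
  have hD'₁ (x : f.source.toScheme) :
      D'.1 (f.source.ι x) = D.1 ((f.iso.hom ≫ f.target.ι) x) := by
    refine (congrArg Int.floor (WeilDivisor.pushforward_apply_of_mem f.symm _ x.2)).trans ?_
    change ⌊(1 : ℚ) * (D.1 ((f.iso.hom ≫ f.target.ι) x) : ℚ)⌋ = _
    rw [one_mul, Int.floor_intCast]
  have hD' : 0 ≤ D' := by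
    intro x
    by_cases hx : x ∈ f.source
    · exact (hD _).trans_eq (hD'₁ ⟨x, hx⟩).symm
    · change 0 ≤ ⌊(WeilDivisor.pushforward f.symm (WeilDivisor.ratSMul 1 D)).1 x⌋
      rw [WeilDivisor.pushforward_apply_of_notMem f.symm _ hx, Int.floor_zero]
  obtain ⟨ε, hε, hΔ, hX⟩ := hX D' hD'
  have hb (y : Y) (hy : y ∈ f.target) : y ∈ Set.range (f.iso.hom ≫ f.target.ι) := by
    refine ⟨f.iso.inv ⟨y, hy⟩, ?_⟩
    change (f.iso.inv ≫ f.iso.hom ≫ f.target.ι) ⟨y, hy⟩ = y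
    rw [Iso.inv_hom_id_assoc]
    rfl
  have hab (z : f.source.toScheme) : (Δ + WeilDivisor.ratSMul ε D').1 (f.source.ι z) =
      (WeilDivisor.pushforward f Δ + WeilDivisor.ratSMul ε D).1
        ((f.iso.hom ≫ f.target.ι) z) := by
    change Δ.1 (f.source.ι z) + ε * (D'.1 (f.source.ι z) : ℚ) =
      (WeilDivisor.pushforward f Δ).1 ((f.iso.hom ≫ f.target.ι) z) +
        ε * (D.1 ((f.iso.hom ≫ f.target.ι) z) : ℚ)
    rw [WeilDivisor.pushforward_apply, hD'₁]
  refine ⟨ε, hε, fun y ↦ ?_, fun T _ _ _ g _ _ ↦ ?_⟩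
  · by_cases hy : y ∈ f.target
    · obtain ⟨z, rfl⟩ := hb y hy
      exact (hΔ _).trans_eq (hab z)
    -- Off the target the pushforward of `Δ` has coefficient zero, and only the effective term `ε D`
    -- remains.
    · change (0 : ℚ) ≤ (WeilDivisor.pushforward f Δ).1 y + ε * (D.1 y : ℚ)
      rw [WeilDivisor.pushforward_apply_of_notMem f Δ hy, zero_add]
      exact mul_nonneg hε.le (Int.cast_nonneg (hD y))
  · have : Nonempty f.source := f.dense_source.nonempty.to_subtype
    have : IsIntegral f.source.toScheme := isIntegral_of_isOpenImmersion f.source.ι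
    refine isSplitMono_plusMap_of_isNagataScheme f.source.ι (f.iso.hom ≫ f.target.ι)
      (fun y hy ↦ hb y (by_contra fun h ↦ ?_)) g hΔ _ hab hX
    -- Smallness: a point outside the target has codimension at least two, so it cannot have
    -- codimension one.
    have := hf.2 y h
    rw [hy] at this
    exact absurd this (by norm_num)
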